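/- For an integer $n\ge 0$, let $DSOME(n)$ be the sum of all the odd parts in all the partitions of $n$ into distinct parts, minus the sum of all the even parts in all the partitions of $n$ into distinct parts (so $DSOME(0)=0$). Then for all integers $n\ge 0$, $$DSOME(15625n+651)\equiv 5\,DSOME(25n+1)+DSOME(625n+26)-5\,DSOME(n)\pmod 8,$$ and, for all integers $n\ge 0$ and $1\le r\le 4$, $$DSOME(15625n+3125r+651)\equiv 5\,DSOME(25n+5r+1)+DSOME(625n+125r+26)\pmod 8.$$ -/

import Mathlib

/-- `DSOME n`: the sum of all the odd parts in all the partitions of `n` into distinct parts,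
minus the sum of all the even parts in these partitions. -/
def DSOME (n : ℕ) : ℤ :=
  (∑ p ∈ Nat.Partition.distincts n, ((p.parts.filter (fun k => Odd k)).sum : ℤ)) -
    ∑ p ∈ Nat.Partition.distincts n, ((p.parts.filter (fun k => Even k)).sum : ℤ)

/-! Write f_k = ∏ (1 - q^(k n)) and φ(q) = ∑ (-1)^j q^(j²) = f_1²/f_2. Modulo 8, a partition of n
into distinct parts has odd-minus-even sum 2 - 3n - 2s, where s = ±1 is the parity sign of the
number of parts not divisible by 4. So DSOME modulo 8 is determined by the series Q = f_1/φ(q),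
counting these partitions, and Q' = f_1/φ(q⁴), counting them with sign s. Since φ ≡ 1 mod 2, φ² ≡ 1
mod 4 and φ⁴ ≡ 1 mod 8, which removes the denominators: Q ≡ (f_1 φ²) φ mod 8, while 2Q ≡ 2 f_1 φ(q)
and 2Q' ≡ 2 f_1 φ(q⁴) mod 8. With f_1 φ² = ∑ (6i+1) q^(i(3i+1)/2)
(`pentagonalSeries_mul_gaussSeries_sq`, from the Jacobi triple product), DSOME becomes a combination
of three weighted counts of the solutions of (6i+1)² + 24j² = 24n + 1 (`DSOME_modEq_latticeSum`).

These solutions are elements 6i+1 + 2j√-6 of norm 24n+1. Multiplication by 1 ± 2√-6, of norm 25,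
gives each count a Hecke recursion a(125m+26) = c a(5m+1) - e a(m/5) (`latticeSum_recurrence`), with
(c, e) = (-2, 25), (-2, 1), (2, 1). Using it twice, everything in the desired congruence cancels
modulo 8 except 4 (a(5m+1) - a(m/5)) for the third count, and that difference is even because modulo
2 this count is the coefficient of f_1 (`two_dvd_latticeSum_sub_divFive`). The two claims are m = 5n
and m = 5n + r. -/

open PowerSeries

/-- The formal power series `∑ i, c i * X ^ e i`, for an exponent function `e` with finite
fibres. -/
noncomputable def thetaSeries {ι : Type*} (c : ι → ℤ) (e : ι → ℕ) : ℤ⟦X⟧ :=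
  .mk fun n => ∑ᶠ i, if e i = n then c i else 0

/-! ### Calculus of theta-type series -/

section thetaSeries

variable {ι κ : Type*} {c : ι → ℤ} {e : ι → ℕ}

theorem coeff_thetaSeries (c : ι → ℤ) (e : ι → ℕ) (n : ℕ) :
    (thetaSeries c e).coeff n = ∑ᶠ i, if e i = n then c i else 0 := by
  simp [thetaSeries]

theorem coeff_thetaSeries_eq_sum (c : ι → ℤ) (e : ι → ℕ) {n : ℕ} {s : Finset ι}
    (hs : ∀ i, e i = n → i ∈ s) :
    (thetaSeries c e).coeff n = ∑ i ∈ s, if e i = n then c i else 0 := by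
  rw [coeff_thetaSeries, finsum_eq_sum_of_support_subset]
  intro i hi
  simp only [Function.mem_support, ne_eq, ite_eq_right_iff, Classical.not_imp] at hi
  exact hs i hi.1

theorem thetaSeries_comp_equiv (σ : κ ≃ ι) (c : ι → ℤ) (e : ι → ℕ) :
    thetaSeries (fun k => c (σ k)) (fun k => e (σ k)) = thetaSeries c e := by
  ext n
  rw [coeff_thetaSeries, coeff_thetaSeries]
  exact finsum_comp_equiv σ (f := fun i => if e i = n then c i else 0)

theorem thetaSeries_neg (c : ι → ℤ) (e : ι → ℕ) :
    thetaSeries (fun i => -c i) e = -thetaSeries c e := by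
  ext n
  rw [map_neg, coeff_thetaSeries, coeff_thetaSeries, ← finsum_neg_distrib]
  exact finsum_congr fun i => by split_ifs <;> simp

theorem thetaSeries_eq_zero_of_antisymm (σ : ι ≃ ι) (hc : ∀ i, c (σ i) = -c i)
    (he : ∀ i, e (σ i) = e i) : thetaSeries c e = 0 := by
  have h := thetaSeries_comp_equiv σ c e
  simp_rw [hc, he, thetaSeries_neg] at h
  ext n
  have := congrArg (coeff n) h
  rw [map_neg] at this
  rw [map_zero]
  change -(coeff n) (thetaSeries c e) = _ at this
  omega

theorem thetaSeries_add (he : ∀ n, {i | e i ≤ n}.Finite) (c c' : ι → ℤ) :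
    thetaSeries (fun i => c i + c' i) e = thetaSeries c e + thetaSeries c' e := by
  ext n
  have hs : ∀ i, e i = n → i ∈ (he n).toFinset := by simp +contextual
  rw [map_add, coeff_thetaSeries_eq_sum _ _ hs, coeff_thetaSeries_eq_sum _ _ hs,
    coeff_thetaSeries_eq_sum _ _ hs, ← Finset.sum_add_distrib]
  exact Finset.sum_congr rfl fun i _ => by split_ifs <;> simp

theorem thetaSeries_sum {c : ι ⊕ κ → ℤ} {e : ι ⊕ κ → ℕ} (he : ∀ n, {i | e i ≤ n}.Finite) :
    thetaSeries c e = thetaSeries (fun i => c (.inl i)) (fun i => e (.inl i)) +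
      thetaSeries (fun k => c (.inr k)) (fun k => e (.inr k)) := by
  ext n
  have hs : ∀ i, e i = n → i ∈ (he n).toFinset := by simp +contextual
  rw [map_add, coeff_thetaSeries_eq_sum c e (s := (he n).toFinset.toLeft.disjSum
    (he n).toFinset.toRight) (by rwa [Finset.toLeft_disjSum_toRight]), Finset.sum_disjSum,
    coeff_thetaSeries_eq_sum _ _ (s := (he n).toFinset.toLeft)
      (fun i hi => Finset.mem_toLeft.mpr (hs _ hi)),
    coeff_thetaSeries_eq_sum _ _ (s := (he n).toFinset.toRight)
      (fun i hi => Finset.mem_toRight.mpr (hs _ hi))]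

theorem thetaSeries_mul {c' : κ → ℤ} {e' : κ → ℕ} (he : ∀ n, {i | e i ≤ n}.Finite)
    (he' : ∀ n, {i | e' i ≤ n}.Finite) :
    thetaSeries c e * thetaSeries c' e' =
      thetaSeries (fun p : ι × κ => c p.1 * c' p.2) (fun p => e p.1 + e' p.2) := by
  ext n
  rw [coeff_mul, coeff_thetaSeries_eq_sum _ _
    (s := (he n).toFinset ×ˢ (he' n).toFinset)
    (by intro i hi; simp only [Finset.mem_product, Set.Finite.mem_toFinset, Set.mem_ofPred_eq]
        omega), Finset.sum_product]
  have key : ∀ p ∈ Finset.HasAntidiagonal.antidiagonal n,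
      (thetaSeries c e).coeff p.1 * (thetaSeries c' e').coeff p.2 =
      ∑ i ∈ (he n).toFinset, ∑ j ∈ (he' n).toFinset,
        (if e i = p.1 then c i else 0) * (if e' j = p.2 then c' j else 0) := by
    intro p hp
    rw [Finset.HasAntidiagonal.mem_antidiagonal] at hp
    rw [coeff_thetaSeries_eq_sum c e (s := (he n).toFinset)
        (by intro i hi; simp only [Set.Finite.mem_toFinset, Set.mem_ofPred_eq]; omega),
      coeff_thetaSeries_eq_sum c' e' (s := (he' n).toFinset)
        (by intro i hi; simp only [Set.Finite.mem_toFinset, Set.mem_ofPred_eq]; omega),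
      Finset.sum_mul_sum]
  rw [Finset.sum_congr rfl key, Finset.sum_comm]
  refine Finset.sum_congr rfl fun i _ => ?_
  rw [Finset.sum_comm]
  refine Finset.sum_congr rfl fun j _ => ?_
  by_cases h : e i + e' j = n
  · rw [Finset.sum_eq_single (e i, e' j)]
    · simp [h]
    · rintro ⟨a, b⟩ _ hne
      by_cases h1 : e i = a
      · rw [if_neg (c := e' j = _) (by rintro rfl; exact hne (by rw [h1])), mul_zero]
      · rw [if_neg h1, zero_mul]
    · intro hn; exact absurd (Finset.HasAntidiagonal.mem_antidiagonal.mpr h) hn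
  · rw [if_neg h]
    refine Finset.sum_eq_zero fun p hp => ?_
    rw [Finset.HasAntidiagonal.mem_antidiagonal] at hp
    by_cases h1 : e i = p.1
    · rw [if_neg (c := e' j = _) (by omega), mul_zero]
    · rw [if_neg h1, zero_mul]

theorem expand_thetaSeries {p : ℕ} (hp : p ≠ 0) (c : ι → ℤ) (e : ι → ℕ) :
    expand p hp (thetaSeries c e) = thetaSeries c (fun i => p * e i) := by
  ext n
  rw [coeff_expand, coeff_thetaSeries, coeff_thetaSeries]
  split_ifs with h
  · obtain ⟨m, rfl⟩ := h
    rw [Nat.mul_div_cancel_left _ (Nat.pos_of_ne_zero hp)]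
    exact finsum_congr fun i => by simp [hp]
  · rw [finsum_eq_zero_of_forall_eq_zero]
    exact fun i => if_neg fun hi => h ⟨_, hi.symm⟩

theorem X_pow_dvd_thetaSeries_sub_sum (c : ι → ℤ) (e : ι → ℕ) {d : ℕ} {s : Finset ι}
    (hs : ∀ i ∉ s, d ≤ e i) :
    X ^ d ∣ thetaSeries c e - ∑ i ∈ s, C (c i) * X ^ e i := by
  rw [X_pow_dvd_iff]
  intro n hn
  rw [map_sub, map_sum, coeff_thetaSeries_eq_sum (s := s), ← Finset.sum_sub_distrib]
  · refine Finset.sum_eq_zero fun i _ => ?_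
    rw [coeff_C_mul, coeff_X_pow]
    by_cases h : e i = n
    · simp [h]
    · simp [h, Ne.symm h]
  · intro i hi
    by_contra h
    have := hs i h
    omega

/-- Non-fixed points pair off with equal values. A sum with infinite support is 0 by convention, so
no finiteness is required. -/
theorem two_dvd_finsum_of_involutive {f : ι → ℤ} (τ : ι → ι) (hτ : Function.Involutive τ)
    (hf : ∀ i, f (τ i) = f i) (h0 : ∀ i, τ i = i → f i = 0) : 2 ∣ ∑ᶠ i, f i := by
  classical
  by_cases hfin : f.support.Finite
  · rw [finsum_eq_sum f hfin]
    change ((2 : ℕ) : ℤ) ∣ _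
    rw [← ZMod.intCast_zmod_eq_zero_iff_dvd, Int.cast_sum]
    refine Finset.sum_involution (fun i _ => τ i) (fun i _ => ?_) (fun i _ hi h => ?_)
      (fun i hi => ?_) (fun i _ => hτ i)
    · rw [hf]; exact CharTwo.add_self_eq_zero _
    · simp [h0 i h] at hi
    · simpa [hf] using hi
  · rw [finsum_of_infinite_support hfin]
    exact dvd_zero 2

theorem exists_thetaSeries_eq_one_add_two_mul {c : ℤ → ℤ} {e : ℤ → ℕ}
    (hc : ∀ j, c (-j) = c j) (he : ∀ j, e (-j) = e j) (hc0 : c 0 = 1) (he0 : ∀ j, e j = 0 ↔ j = 0) :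
    ∃ S : ℤ⟦X⟧, thetaSeries c e = 1 + 2 * S := by
  have h : ∀ n, ∃ a, (thetaSeries c e).coeff n = (1 : ℤ⟦X⟧).coeff n + 2 * a := by
    intro n
    have h1 : (1 : ℤ⟦X⟧).coeff n = ∑ i ∈ {(0 : ℤ)}, if e i = n then c i else 0 := by
      rw [coeff_one, Finset.sum_singleton, hc0, (he0 0).mpr rfl]
      simp [eq_comm]
    rcases eq_or_ne n 0 with rfl | hn
    · refine ⟨0, ?_⟩
      rw [h1, coeff_thetaSeries_eq_sum _ _ (s := {(0 : ℤ)}) (by simp [he0])]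
      simp
    · obtain ⟨a, ha⟩ := two_dvd_finsum_of_involutive (f := fun i => if e i = n then c i else 0)
        (fun j : ℤ => -j) neg_involutive (by simp [hc, he]) (by
          intro i hi
          have hi0 : i = 0 := by omega
          subst hi0
          rw [(he0 0).mpr rfl, if_neg hn.symm])
      exact ⟨a, by rw [coeff_thetaSeries, ha]; simp [coeff_one, hn]⟩
  choose a ha using h
  refine ⟨.mk a, ?_⟩
  ext n
  rw [ha n, map_add, ← map_ofNat (C (R := ℤ)) 2, coeff_C_mul, coeff_mk]

end thetaSeries

/-! ### Gaussian binomials and the finite Jacobi triple product -/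

section qBinom

variable {A B : Type*} [CommRing A] [CommRing B]

/-- The Gaussian binomial coefficient `[n, k]_q`. -/
def qBinom (q : A) : ℕ → ℕ → A
  | _, 0 => 1
  | 0, _ + 1 => 0
  | n + 1, k + 1 => q ^ (k + 1) * qBinom q n (k + 1) + qBinom q n k

/-- The finite Euler product `(1 - q) (1 - q ^ 2) ⋯ (1 - q ^ m)`. -/
def qPoch (q : A) (m : ℕ) : A := ∏ i ∈ Finset.range m, (1 - q ^ (i + 1))

@[simp] theorem qBinom_zero_right (q : A) (n : ℕ) : qBinom q n 0 = 1 := by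
  cases n <;> rfl

theorem qBinom_succ_succ (q : A) (n k : ℕ) :
    qBinom q (n + 1) (k + 1) = q ^ (k + 1) * qBinom q n (k + 1) + qBinom q n k := rfl

theorem qBinom_eq_zero_of_lt (q : A) {n k : ℕ} (h : n < k) : qBinom q n k = 0 := by
  induction n generalizing k with
  | zero => obtain ⟨k, rfl⟩ := Nat.exists_eq_succ_of_ne_zero h.ne'; rfl
  | succ n ih =>
    obtain ⟨k, rfl⟩ := Nat.exists_eq_succ_of_ne_zero (Nat.ne_zero_of_lt h)
    rw [qBinom_succ_succ, ih (by omega), ih (by omega), mul_zero, add_zero]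

theorem map_qBinom (f : A →+* B) (q : A) (n k : ℕ) : f (qBinom q n k) = qBinom (f q) n k := by
  induction n generalizing k with
  | zero => cases k <;> simp [qBinom]
  | succ n ih => cases k <;> simp [qBinom, ih]

theorem one_sub_mul_qBinom_succ (q : A) {n k : ℕ} (h : k ≤ n) :
    (1 - q ^ (k + 1)) * qBinom q n (k + 1) = (1 - q ^ (n - k)) * qBinom q n k := by
  induction n generalizing k with
  | zero => obtain rfl : k = 0 := by omega
            simp [qBinom]
  | succ n ih =>
    rcases h.eq_or_lt with rfl | hk
    · simp [qBinom_eq_zero_of_lt]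
    have hk : k ≤ n := by omega
    have h1 : (1 - q ^ (k + 1)) * qBinom q (n + 1) (k + 1) = (1 - q ^ (n + 1)) * qBinom q n k := by
      rw [qBinom_succ_succ, mul_add, mul_left_comm, ih hk]
      have : q ^ (n + 1) = q ^ (k + 1) * q ^ (n - k) := by rw [← pow_add]; congr 1; omega
      rw [this]; ring
    rw [h1]
    rcases k with _ | k
    · simp
    · rw [qBinom_succ_succ]
      have h2 := ih (k := k) (by omega)
      have e1 : n + 1 - (k + 1) = n - k := by omega
      rw [e1]
      have : q ^ (n + 1) = q ^ (k + 1) * q ^ (n - k) := by rw [← pow_add]; congr 1; omega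
      rw [this]; linear_combination h2

theorem qBinom_succ_succ' (q : A) (n k : ℕ) :
    qBinom q (n + 1) (k + 1) = qBinom q n (k + 1) + q ^ (n - k) * qBinom q n k := by
  rcases le_or_gt k n with h | h
  · rw [qBinom_succ_succ]
    linear_combination -one_sub_mul_qBinom_succ q h
  · simp [qBinom_eq_zero_of_lt q h, qBinom_eq_zero_of_lt q (show n < k + 1 by omega),
      qBinom_eq_zero_of_lt q (show n + 1 < k + 1 by omega)]

theorem qBinom_mul_qPoch_mul_qPoch (q : A) {n k : ℕ} (h : k ≤ n) :
    qBinom q n k * qPoch q k * qPoch q (n - k) = qPoch q n := by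
  induction k with
  | zero => simp [qPoch]
  | succ k ih =>
    have e : n - k = (n - (k + 1)) + 1 := by omega
    have h1 := ih (by omega)
    have h2 := one_sub_mul_qBinom_succ q (show k ≤ n by omega)
    have h3 : qPoch q (n - k) = qPoch q (n - (k + 1)) * (1 - q ^ (n - k)) := by
      rw [e, qPoch, Finset.prod_range_succ, ← qPoch]
    have h4 : qPoch q (k + 1) = qPoch q k * (1 - q ^ (k + 1)) := by
      rw [qPoch, Finset.prod_range_succ, ← qPoch]
    rw [← h1, h3, h4]
    linear_combination qPoch q k * qPoch q (n - (k + 1)) * h2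

/-- The triangular number `j (j - 1) / 2`. -/
def triangular (j : ℤ) : ℕ := (j * (j - 1) / 2).toNat

theorem two_mul_triangular (j : ℤ) : 2 * (triangular j : ℤ) = j * (j - 1) := by
  have h : Even (j * (j - 1)) := Int.even_mul_pred_self j
  have h0 : 0 ≤ j * (j - 1) := by
    rcases le_or_gt j 0 with h | h <;> nlinarith
  rw [triangular, Int.toNat_of_nonneg (by omega)]
  exact Int.two_mul_ediv_two_of_even h

theorem triangular_add_one (j : ℤ) : (triangular (j + 1) : ℤ) = triangular j + j := by
  have h1 := two_mul_triangular j
  have h2 := two_mul_triangular (j + 1)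
  linarith

/-- The induction step for the finite triple product: each new factor is linear in z, and the
coefficient hypotheses are supplied by the Pascal rules for `qBinom`. -/
theorem linear_mul_sum_range {a b : ℕ → A} {α β z : A} {N : ℕ} (h0 : b 0 = α * a 0)
    (hs : ∀ k, b (k + 1) = α * a (k + 1) + β * a k) (hN : a (N + 1) = 0) :
    (∑ k ∈ Finset.range (N + 1), a k * z ^ k) * (α + β * z) =
      ∑ k ∈ Finset.range (N + 2), b k * z ^ k := by
  rw [Finset.sum_range_succ' (fun k => b k * z ^ k)]
  have : ∑ k ∈ Finset.range (N + 1), b (k + 1) * z ^ (k + 1) =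
      α * ∑ k ∈ Finset.range (N + 1), a (k + 1) * z ^ (k + 1) +
        β * z * ∑ k ∈ Finset.range (N + 1), a k * z ^ k := by
    rw [Finset.mul_sum, Finset.mul_sum, ← Finset.sum_add_distrib]
    exact Finset.sum_congr rfl fun k _ => by rw [hs]; ring
  rw [this, h0]
  have h1 : ∑ k ∈ Finset.range (N + 1), a (k + 1) * z ^ (k + 1) + a 0 =
      ∑ k ∈ Finset.range (N + 1), a k * z ^ k := by
    have := Finset.sum_range_succ' (fun k => a k * z ^ k) (N + 1)
    rw [Finset.sum_range_succ, hN] at this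
    simpa using this.symm
  linear_combination -α * h1

theorem finite_triple_product_zero (q z : A) (n : ℕ) :
    ∏ i ∈ Finset.range n, (z - q ^ (i + 1)) =
      ∑ k ∈ Finset.range (n + 1),
        ((-1) ^ (n + k) * q ^ triangular (k - n) * qBinom q n k) * z ^ k := by
  induction n with
  | zero => simp [triangular]
  | succ n ih =>
    rw [Finset.prod_range_succ, ih,
      show z - q ^ (n + 1) = -q ^ (n + 1) + 1 * z by ring]
    refine linear_mul_sum_range ?_ (fun k => ?_) ?_
    · have h : triangular ((0 : ℕ) - (n + 1 : ℕ)) = n + 1 + triangular ((0 : ℕ) - n) := by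
        have := triangular_add_one (-n - 1)
        rw [show (-n - 1 + 1 : ℤ) = (0 : ℕ) - n by push_cast; ring,
          show (-n - 1 : ℤ) = (0 : ℕ) - (n + 1 : ℕ) by push_cast; ring] at this
        push_cast at this ⊢
        omega
      rw [h]; simp; ring
    · have h : triangular ((k + 1 : ℕ) - (n + 1 : ℕ)) + (k + 1) =
          n + 1 + triangular ((k + 1 : ℕ) - n) := by
        have := triangular_add_one (k - n)
        rw [show ((k : ℤ) - n + 1 : ℤ) = (k + 1 : ℕ) - n by push_cast; ring,
          show (k - n : ℤ) = (k + 1 : ℕ) - (n + 1 : ℕ) by push_cast; ring] at this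
        push_cast at this ⊢
        omega
      have h' : triangular ((k + 1 : ℕ) - (n + 1 : ℕ)) = triangular (k - n) := by
        congr 1; push_cast; ring
      have h'' := congrArg (q ^ ·) h
      simp only [pow_add, h'] at h''
      rw [qBinom_succ_succ, h']
      linear_combination (-1) ^ (n + k) * qBinom q n (k + 1) * h''
    · simp [qBinom_eq_zero_of_lt]

/-- The finite Jacobi triple product identity. -/
theorem finite_triple_product (q z : A) (m n : ℕ) :
    (∏ i ∈ Finset.range n, (z - q ^ (i + 1))) * ∏ i ∈ Finset.range m, (1 - z * q ^ i) =
      ∑ k ∈ Finset.range (m + n + 1),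
        ((-1) ^ (n + k) * q ^ triangular (k - n) * qBinom q (m + n) k) * z ^ k := by
  induction m with
  | zero => simp [finite_triple_product_zero]
  | succ m ih =>
    rw [Finset.prod_range_succ, ← mul_assoc, ih,
      show 1 - z * q ^ m = 1 + -q ^ m * z by ring, show m + 1 + n = m + n + 1 by ring]
    refine linear_mul_sum_range ?_ (fun k => ?_) ?_
    · simp
    · rw [qBinom_succ_succ']
      rcases le_or_gt k (m + n) with hk | hk
      · have h : triangular ((k + 1 : ℕ) - n) + (m + n - k) = m + triangular (k - n) := by
          have := triangular_add_one (k - n)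
          rw [show ((k : ℤ) - n + 1 : ℤ) = (k + 1 : ℕ) - n by push_cast; ring] at this
          omega
        have h' := congrArg (q ^ ·) h
        simp only [pow_add] at h'
        linear_combination (-1) ^ (n + k + 1) * qBinom q (m + n) k * h'
      · simp [qBinom_eq_zero_of_lt q hk]
    · simp [qBinom_eq_zero_of_lt]

end qBinom

/-! ### Passage from finite products to Euler's function, X-adically -/

section EulerProduct

theorem eq_of_forall_X_pow_dvd_sub {f g : ℤ⟦X⟧} (h : ∀ n, X ^ n ∣ f - g) : f = g := by
  ext n
  have := X_pow_dvd_iff.mp (h (n + 1)) n n.lt_succ_self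
  rwa [map_sub, sub_eq_zero] at this

theorem constantCoeff_pentagonalSeries : constantCoeff (pentagonalSeries ℤ) = 1 := by
  have := coeff_pentagonalSeries_pentagonal ℤ 0
  simpa [pentagonal] using this

theorem isUnit_pentagonalSeries : IsUnit (pentagonalSeries ℤ) := by
  rw [isUnit_iff_constantCoeff, constantCoeff_pentagonalSeries]
  exact isUnit_one

theorem pentagonalSeries_ne_zero : pentagonalSeries ℤ ≠ 0 := isUnit_pentagonalSeries.ne_zero

theorem isUnit_expand_pentagonalSeries {p : ℕ} (hp : p ≠ 0) :
    IsUnit (expand p hp (pentagonalSeries ℤ)) :=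
  isUnit_pentagonalSeries.map (expand p hp)

theorem X_pow_dvd_qPoch_sub_qPoch {m M : ℕ} (h : m ≤ M) :
    (X : ℤ⟦X⟧) ^ (m + 1) ∣ qPoch X M - qPoch X m := by
  induction M, h using Nat.le_induction with
  | base => simp
  | succ M hM ih =>
    have : qPoch (X : ℤ⟦X⟧) (M + 1) - qPoch X m =
        (qPoch X M - qPoch X m) - X ^ (M + 1) * qPoch X M := by
      rw [qPoch, Finset.prod_range_succ, ← qPoch]; ring
    rw [this]
    exact dvd_sub ih (dvd_mul_of_dvd_left (pow_dvd_pow _ (by omega)) _)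

theorem X_pow_dvd_qPoch_sub_pentagonalSeries (m : ℕ) :
    (X : ℤ⟦X⟧) ^ (m + 1) ∣ qPoch X m - pentagonalSeries ℤ := by
  rw [X_pow_dvd_iff]
  intro n hn
  have h := coeff_prod_one_sub_X_pow_eventually_eq ℤ n
  obtain ⟨M, hM, hmM⟩ := ((Filter.tendsto_finset_range.eventually h).and
    (Filter.eventually_ge_atTop m)).exists
  have h1 := X_pow_dvd_iff.mp (X_pow_dvd_qPoch_sub_qPoch hmM) n hn
  rw [map_sub, sub_eq_zero] at h1 ⊢
  rw [← h1, ← hM, qPoch]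

/-- In [n, k] (q)_k (q)_(n-k) = (q)_n all three finite products agree with Euler's function to order
r + 1, and one factor of that unit cancels. -/
theorem X_pow_dvd_pentagonalSeries_mul_qBinom_sub_one {n k r : ℕ} (hk : r ≤ k) (hn : k + r ≤ n) :
    (X : ℤ⟦X⟧) ^ (r + 1) ∣ pentagonalSeries ℤ * qBinom X n k - 1 := by
  have hd : ∀ m, r ≤ m → (X : ℤ⟦X⟧) ^ (r + 1) ∣ qPoch X m - pentagonalSeries ℤ := fun m hm =>
    (pow_dvd_pow _ (by omega)).trans (X_pow_dvd_qPoch_sub_pentagonalSeries m)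
  obtain ⟨a, ha⟩ := hd k hk
  obtain ⟨b, hb⟩ := hd (n - k) (by omega)
  obtain ⟨c, hc⟩ := hd n (by omega)
  have h := qBinom_mul_qPoch_mul_qPoch (X : ℤ⟦X⟧) (show k ≤ n by omega)
  rw [sub_eq_iff_eq_add] at ha hb hc
  rw [ha, hb, hc] at h
  rw [← isUnit_pentagonalSeries.dvd_mul_left]
  refine ⟨c - qBinom X n k * (a * (X ^ (r + 1) * b + pentagonalSeries ℤ) +
    pentagonalSeries ℤ * b), ?_⟩
  linear_combination h

theorem X_pow_dvd_thetaSeries_sub_sum_range (c : ℤ → ℤ) (e : ℤ → ℕ) {d m n : ℕ}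
    (hm : ∀ j : ℤ, m < j → d ≤ e j) (hn : ∀ j : ℤ, j < -n → d ≤ e j) :
    X ^ d ∣ thetaSeries c e -
      ∑ k ∈ Finset.range (m + n + 1), C (c (k - n)) * X ^ e (k - n) := by
  have h := X_pow_dvd_thetaSeries_sub_sum c e (d := d)
    (s := (Finset.range (m + n + 1)).image fun k : ℕ => (k : ℤ) - n) (by
      intro i hi
      by_cases h1 : m < i
      · exact hm i h1
      by_cases h2 : i < -n
      · exact hn i h2
      exfalso
      refine hi (Finset.mem_image.mpr ⟨(i + n).toNat, ?_, ?_⟩)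
      · rw [Finset.mem_range]; omega
      · rw [Int.toNat_of_nonneg (by omega)]; ring)
  rwa [Finset.sum_image (by intro a _ b _ h; simpa using h)] at h

/-- Multiplying by Euler's function turns Gaussian binomials into `1` up to high order. -/
theorem X_pow_dvd_sum_mul_qBinom_sub_sum {p : ℕ} (hp : p ≠ 0) (c : ℤ → ℤ) (e : ℤ → ℕ) {d m n : ℕ}
    (h1 : ∀ j : ℤ, (d : ℤ) ≤ p * (n + j + 1) + e j) (h2 : ∀ j : ℤ, (d : ℤ) ≤ p * (m - j + 1) + e j) :
    X ^ d ∣ expand p hp (pentagonalSeries ℤ) * ∑ k ∈ Finset.range (m + n + 1),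
        C (c (k - n)) * X ^ e (k - n) * qBinom (X ^ p) (m + n) k -
      ∑ k ∈ Finset.range (m + n + 1), C (c (k - n)) * X ^ e (k - n) := by
  rw [Finset.mul_sum, ← Finset.sum_sub_distrib]
  refine Finset.dvd_sum fun k hk => ?_
  rw [Finset.mem_range] at hk
  set r := min k (m + n - k) with hr
  obtain ⟨a, ha⟩ := X_pow_dvd_pentagonalSeries_mul_qBinom_sub_one (n := m + n) (k := k) (r := r)
    (by omega) (by omega)
  have ha' := congrArg (expand p hp) ha
  have hq := map_qBinom (expand p hp : ℤ⟦X⟧ →ₐ[ℤ] ℤ⟦X⟧).toRingHom X (m + n) k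
  simp only [AlgHom.toRingHom_eq_coe, RingHom.coe_coe, expand_X] at hq
  rw [map_sub, map_mul, map_mul, map_pow, expand_X, map_one, hq, ← pow_mul] at ha'
  -- The binomial contributes an error of order p (r + 1) with r the distance of k to the nearer
  -- end; `h1` covers one end and `h2` the other.
  have hd : d ≤ e (k - n) + p * (r + 1) := by
    have h1 := h1 (k - n)
    have h2 := h2 (k - n)
    rcases min_choice k (m + n - k) with h | h
    · rw [hr, h]; zify
      have e1 : (n + (k - n : ℤ) + 1) = k + 1 := by ring
      rw [e1] at h1; linarith
    · rw [hr, h]; zify [show k ≤ m + n by omega]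
      have e1 : (m - (k - n : ℤ) + 1) = m + n - k + 1 := by ring
      rw [e1] at h2; linarith
  obtain ⟨t, ht⟩ := Nat.exists_eq_add_of_le hd
  refine ⟨C (c (k - n)) * X ^ t * expand p hp a, ?_⟩
  have h3 := congrArg ((X : ℤ⟦X⟧) ^ ·) ht
  simp only [pow_add] at h3
  linear_combination (C (c (k - n)) * X ^ e (k - n)) * ha' + C (c (k - n)) * expand p hp a * h3

end EulerProduct

/-! ### Gauss's product formula for φ -/

section Gauss

/-- Gauss's theta series `∑ j, (-1) ^ j * X ^ (j ^ 2)`. -/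
noncomputable def gaussSeries : ℤ⟦X⟧ :=
  thetaSeries (fun j : ℤ => (j.negOnePow : ℤ)) (fun j => (j ^ 2).toNat)

theorem neg_one_pow_add_eq_negOnePow_sub (n k : ℕ) :
    (-1 : ℤ⟦X⟧) ^ (n + k) = C (((k - n : ℤ).negOnePow : ℤˣ) : ℤ) := by
  have : ((k - n : ℤ).negOnePow : ℤˣ) = (n + k : ℤ).negOnePow := by
    rw [Int.negOnePow_eq_iff]; exact ⟨-n, by ring⟩
  rw [this]
  have h := Int.coe_negOnePow_natCast (n + k)
  push_cast at h
  rw [h]; simp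

theorem prod_one_sub_odd_mul_expand_qPoch (n : ℕ) :
    (∏ i ∈ Finset.range n, (1 - (X : ℤ⟦X⟧) ^ (2 * i + 1))) * qPoch (X ^ 2) n = qPoch X (2 * n) := by
  induction n with
  | zero => simp [qPoch]
  | succ n ih =>
    have h1 : qPoch (X ^ 2 : ℤ⟦X⟧) (n + 1) = qPoch (X ^ 2) n * (1 - X ^ (2 * n + 2)) := by
      rw [qPoch, Finset.prod_range_succ, ← qPoch, ← pow_mul, mul_add, mul_one]
    have h2 : qPoch (X : ℤ⟦X⟧) (2 * (n + 1)) =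
        qPoch X (2 * n) * (1 - X ^ (2 * n + 1)) * (1 - X ^ (2 * n + 2)) := by
      rw [mul_add, mul_one, qPoch, Finset.prod_range_succ, Finset.prod_range_succ, ← qPoch]
    rw [Finset.prod_range_succ, h1, h2, ← ih]; ring

theorem X_pow_dvd_prod_one_sub_odd (n : ℕ) :
    X ^ n ∣ expand 2 two_ne_zero (pentagonalSeries ℤ) *
      (∏ i ∈ Finset.range n, (1 - (X : ℤ⟦X⟧) ^ (2 * i + 1))) - pentagonalSeries ℤ := by
  obtain ⟨a, ha⟩ := X_pow_dvd_qPoch_sub_pentagonalSeries n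
  obtain ⟨b, hb⟩ := X_pow_dvd_qPoch_sub_pentagonalSeries (2 * n)
  have ha' := congrArg (expand 2 two_ne_zero) ha
  have hq : expand 2 two_ne_zero (qPoch (X : ℤ⟦X⟧) n) = qPoch (X ^ 2) n := by
    simp [qPoch, map_prod]
  rw [map_sub, map_mul, map_pow, expand_X, hq] at ha'
  have h := prod_one_sub_odd_mul_expand_qPoch n
  refine ⟨X ^ (n + 1) * b - X ^ (n + 2) * expand 2 two_ne_zero a *
    ∏ i ∈ Finset.range n, (1 - (X : ℤ⟦X⟧) ^ (2 * i + 1)), ?_⟩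
  linear_combination h + hb - (∏ i ∈ Finset.range n, (1 - (X : ℤ⟦X⟧) ^ (2 * i + 1))) * ha'

theorem sum_mul_qBinom_eq_prod_one_sub_odd_sq (n : ℕ) :
    ∑ k ∈ Finset.range (n + n + 1), C (((k - n : ℤ).negOnePow : ℤˣ) : ℤ) *
      X ^ ((k - n : ℤ) ^ 2).toNat * qBinom (X ^ 2) (n + n) k =
    (∏ i ∈ Finset.range n, (1 - (X : ℤ⟦X⟧) ^ (2 * i + 1))) ^ 2 := by
  -- At base X² and z = X both products become ∏ (1 - X^(2i+1)), the first one up to a factor X^n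
  -- that is cancelled below.
  have h := finite_triple_product (X ^ 2 : ℤ⟦X⟧) X n n
  have h1 : ∏ i ∈ Finset.range n, ((X : ℤ⟦X⟧) - (X ^ 2) ^ (i + 1)) =
      X ^ n * ∏ i ∈ Finset.range n, (1 - (X : ℤ⟦X⟧) ^ (2 * i + 1)) := by
    rw [← Finset.card_range n, ← Finset.prod_const, Finset.card_range, ← Finset.prod_mul_distrib]
    exact Finset.prod_congr rfl fun i _ => by ring
  have h2 : ∏ i ∈ Finset.range n, (1 - (X : ℤ⟦X⟧) * (X ^ 2) ^ i) =
      ∏ i ∈ Finset.range n, (1 - (X : ℤ⟦X⟧) ^ (2 * i + 1)) :=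
    Finset.prod_congr rfl fun i _ => by ring
  refine mul_left_cancel₀ (pow_ne_zero n (X_ne_zero (R := ℤ))) ?_
  rw [h1, h2] at h
  rw [pow_two (Finset.prod _ _), ← mul_assoc, h, Finset.mul_sum]
  refine Finset.sum_congr rfl fun k _ => ?_
  rw [neg_one_pow_add_eq_negOnePow_sub, ← pow_mul]
  have e : n + ((k - n : ℤ) ^ 2).toNat = 2 * triangular (k - n) + k := by
    have h1 := two_mul_triangular (k - n)
    have h2 : (((k - n : ℤ) ^ 2).toNat : ℤ) = (k - n : ℤ) ^ 2 := Int.toNat_of_nonneg (sq_nonneg _)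
    zify; rw [h2]; linear_combination -h1
  have e' := congrArg ((X : ℤ⟦X⟧) ^ ·) e
  simp only [pow_add] at e'
  linear_combination C (((k - n : ℤ).negOnePow : ℤˣ) : ℤ) * qBinom (X ^ 2) (n + n) k * e'

/-- Gauss's product formula `∑ (-1) ^ j q ^ (j ^ 2) = ∏ (1 - q ^ n) ^ 2 / (1 - q ^ (2 n))`. -/
theorem gaussSeries_mul_expand_two :
    gaussSeries * expand 2 two_ne_zero (pentagonalSeries ℤ) = pentagonalSeries ℤ ^ 2 := by
  refine eq_of_forall_X_pow_dvd_sub fun n => ?_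
  have hsq : ∀ j : ℤ, ((j ^ 2).toNat : ℤ) = j ^ 2 := fun j => Int.toNat_of_nonneg (sq_nonneg j)
  obtain ⟨a, ha⟩ := X_pow_dvd_thetaSeries_sub_sum_range (fun j : ℤ => (j.negOnePow : ℤ))
    (fun j => (j ^ 2).toNat) (d := n) (m := n) (n := n)
    (by intro j hj; zify; rw [hsq]; nlinarith) (by intro j hj; zify; rw [hsq]; nlinarith)
  obtain ⟨b, hb⟩ := X_pow_dvd_sum_mul_qBinom_sub_sum two_ne_zero (fun j : ℤ => (j.negOnePow : ℤ))
    (fun j => (j ^ 2).toNat) (d := n) (m := n) (n := n)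
    (by intro j; rw [hsq]; push_cast; nlinarith [sq_nonneg (j + 1)])
    (by intro j; rw [hsq]; push_cast; nlinarith [sq_nonneg (j - 1)])
  obtain ⟨c, hc⟩ := X_pow_dvd_prod_one_sub_odd n
  rw [sum_mul_qBinom_eq_prod_one_sub_odd_sq] at hb
  rw [← gaussSeries] at ha
  set F := expand 2 two_ne_zero (pentagonalSeries ℤ)
  set P := ∏ i ∈ Finset.range n, (1 - (X : ℤ⟦X⟧) ^ (2 * i + 1))
  refine ⟨a * F - b * F + c * (F * P + pentagonalSeries ℤ), ?_⟩
  linear_combination F * ha - F * hb + (F * P + pentagonalSeries ℤ) * hc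

end Gauss

/-! ### Jacobi's identity for the cube of Euler's function -/

section Jacobi

/-- The series `∑ j, (-1) ^ j * j * X ^ (j (j - 1) / 2)`. -/
noncomputable def jacobiSeries : ℤ⟦X⟧ :=
  thetaSeries (fun j : ℤ => (j.negOnePow : ℤ) * j) triangular

theorem sum_mul_qBinom_eq_neg_qPoch_sq (n : ℕ) :
    ∑ k ∈ Finset.range (n + 1 + n + 1), C ((((k - n : ℤ).negOnePow : ℤˣ) : ℤ) * (k - n)) *
      X ^ triangular (k - n) * qBinom (X ^ 1) (n + 1 + n) k = -qPoch (X : ℤ⟦X⟧) n ^ 2 := by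
  have h := finite_triple_product (Polynomial.C (X : ℤ⟦X⟧)) Polynomial.X (n + 1) n
  -- The product contains the factor 1 - z. At z = 1 the sum therefore vanishes, and its derivative
  -- is minus the product of the other factors. Subtracting n times the vanishing sum turns the
  -- weight k into k - n.
  have h0 := congrArg (Polynomial.eval 1) h
  have h1 := congrArg (fun f => Polynomial.eval 1 (Polynomial.derivative f)) h
  have hq : ∀ k, qBinom (Polynomial.C (X : ℤ⟦X⟧)) (n + 1 + n) k =
      Polynomial.C (qBinom X (n + 1 + n) k) := fun k => (map_qBinom Polynomial.C _ _ _).symm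
  have hterm : ∀ k : ℕ, (-1) ^ (n + k) * Polynomial.C (X : ℤ⟦X⟧) ^ triangular (k - n) *
      qBinom (Polynomial.C X) (n + 1 + n) k = Polynomial.C ((-1) ^ (n + k) *
        X ^ triangular (k - n) * qBinom X (n + 1 + n) k) := by
    intro k; rw [hq]; simp
  simp only [hterm] at h0 h1
  rw [Finset.prod_range_succ'] at h0 h1
  simp only [Polynomial.eval_mul, Polynomial.eval_prod, Polynomial.eval_sub, Polynomial.eval_X,
    Polynomial.eval_one, Polynomial.eval_pow, Polynomial.eval_C, pow_zero, mul_one, sub_self,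
    mul_zero, Polynomial.eval_finsetSum, one_pow] at h0
  rw [← mul_assoc, Polynomial.derivative_mul] at h1
  simp only [Polynomial.eval_mul, Polynomial.eval_prod, Polynomial.eval_sub, Polynomial.eval_X,
    Polynomial.eval_one, Polynomial.eval_pow, Polynomial.eval_C, pow_zero, mul_one, sub_self,
    mul_zero, Polynomial.eval_finsetSum, one_pow, Polynomial.derivative_sum,
    Polynomial.derivative_C_mul, Polynomial.derivative_X_pow, Polynomial.eval_add,
    Polynomial.derivative_sub, Polynomial.derivative_one, Polynomial.derivative_X, zero_add,
    zero_sub, mul_neg, one_mul, Polynomial.eval_neg, Polynomial.eval_natCast, map_natCast] at h1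
  rw [← qPoch] at h1
  rw [sq, h1]
  refine Eq.trans ?_ (sub_zero _)
  rw [← mul_zero (n : ℤ⟦X⟧), h0, Finset.mul_sum, ← Finset.sum_sub_distrib]
  refine Finset.sum_congr rfl fun k _ => ?_
  rw [neg_one_pow_add_eq_negOnePow_sub, pow_one]
  simp only [map_mul, map_sub, map_natCast]
  ring

/-- Jacobi's identity for the cube of Euler's function. -/
theorem jacobiSeries_eq : jacobiSeries = -pentagonalSeries ℤ ^ 3 := by
  refine eq_of_forall_X_pow_dvd_sub fun n => ?_
  have ht := two_mul_triangular
  obtain ⟨a, ha⟩ := X_pow_dvd_thetaSeries_sub_sum_range (fun j : ℤ => (j.negOnePow : ℤ) * j)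
    triangular (d := n) (m := n + 1) (n := n)
    (by intro j hj; have := ht j; zify; push_cast at hj; nlinarith)
    (by intro j hj; have := ht j; zify; nlinarith)
  obtain ⟨b, hb⟩ := X_pow_dvd_sum_mul_qBinom_sub_sum one_ne_zero
    (fun j : ℤ => (j.negOnePow : ℤ) * j) triangular (d := n) (m := n + 1) (n := n)
    (by intro j; have := ht j; push_cast; nlinarith [sq_nonneg (2 * j + 1)])
    (by intro j; have := ht j; push_cast; nlinarith [sq_nonneg (2 * j - 3)])
  obtain ⟨c, hc⟩ := X_pow_dvd_qPoch_sub_pentagonalSeries n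
  rw [sum_mul_qBinom_eq_neg_qPoch_sq, expand_one_apply] at hb
  rw [← jacobiSeries] at ha
  set E := pentagonalSeries ℤ
  refine ⟨a - b - E * X * c * (qPoch X n + E), ?_⟩
  linear_combination ha - hb - E * (qPoch X n + E) * hc

end Jacobi

/-! ### The identity f₁ φ² = ∑ (6i+1) q^(i(3i+1)/2) -/

section Quintuple

theorem finite_setOf_le_of_abs_le {e : ℤ → ℕ} (he : ∀ i, |i| ≤ e i + 1) (n : ℕ) :
    {i | e i ≤ n}.Finite := by
  refine (Set.finite_Icc (-(n + 1) : ℤ) (n + 1)).subset fun i hi => ?_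
  have h : e i ≤ n := hi
  have := abs_le.mp (he i)
  rw [Set.mem_Icc]
  omega

theorem finite_setOf_pentagonal_neg_le (n : ℕ) : {i : ℤ | pentagonal (-i) ≤ n}.Finite := by
  refine finite_setOf_le_of_abs_le (fun i => ?_) n
  have := two_mul_natCast_pentagonal_neg i
  rw [abs_le]
  constructor <;> nlinarith

theorem finite_setOf_two_mul_pentagonal_neg_le (n : ℕ) :
    {i : ℤ | 2 * pentagonal (-i) ≤ n}.Finite :=
  (finite_setOf_pentagonal_neg_le n).subset fun i hi => by
    have : 2 * pentagonal (-i) ≤ n := hi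
    change pentagonal (-i) ≤ n
    omega

theorem finite_setOf_sq_le (n : ℕ) : {i : ℤ | (i ^ 2).toNat ≤ n}.Finite := by
  refine finite_setOf_le_of_abs_le (fun i => ?_) n
  rw [Int.toNat_of_nonneg (sq_nonneg i), abs_le]
  constructor <;> nlinarith

theorem finite_setOf_triangular_le (n : ℕ) : {i : ℤ | triangular i ≤ n}.Finite := by
  refine finite_setOf_le_of_abs_le (fun i => ?_) n
  have := two_mul_triangular i
  rw [abs_le]
  constructor <;> nlinarith [sq_nonneg (i - 1), sq_nonneg (2 * i - 3), sq_nonneg (2 * i + 1)]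

theorem finite_setOf_add_le {ι κ : Type*} {e : ι → ℕ} {e' : κ → ℕ}
    (he : ∀ n, {i | e i ≤ n}.Finite) (he' : ∀ n, {i | e' i ≤ n}.Finite) (n : ℕ) :
    {p : ι × κ | e p.1 + e' p.2 ≤ n}.Finite :=
  ((he n).prod (he' n)).subset fun p hp => by
    have : e p.1 + e' p.2 ≤ n := hp
    exact ⟨show e p.1 ≤ n by omega, show e' p.2 ≤ n by omega⟩

theorem pentagonalSeries_eq_thetaSeries :
    pentagonalSeries ℤ =
      thetaSeries (fun i : ℤ => (i.negOnePow : ℤ)) (fun i => pentagonal (-i)) := by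
  ext n
  by_cases hn : n ∈ Set.range pentagonal
  · obtain ⟨k, rfl⟩ := hn
    rw [coeff_thetaSeries_eq_sum _ _ (s := {-k}) (by
      intro i hi; rw [pentagonal_inj] at hi; rw [Finset.mem_singleton]; omega)]
    rw [coeff_pentagonalSeries_pentagonal, Finset.sum_singleton, neg_neg, if_pos rfl,
      Int.negOnePow_neg, Int.cast_id]
  · rw [coeff_pentagonalSeries_eq_zero ℤ hn, coeff_thetaSeries_eq_sum _ _ (s := ∅)
      fun i hi => (hn ⟨-i, hi⟩).elim]
    simp

/-- The series `∑ i, (6 i + 1) * X ^ (i (3 i + 1) / 2)`. -/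
noncomputable def linearPentagonalSeries : ℤ⟦X⟧ :=
  thetaSeries (fun i : ℤ => 6 * i + 1) (fun i => pentagonal (-i))

/-- The change of variables splitting `(m, n)` by the residue of `m + 2 n` modulo `3`. -/
def residueSplit : (ℤ × ℤ) ⊕ ((ℤ × ℤ) ⊕ (ℤ × ℤ)) → ℤ × ℤ
  | .inl (l, t) => (-l - 2 * t, t - l)
  | .inr (.inl (l, t)) => (l + 1 + 2 * t, l - t)
  | .inr (.inr (l, n)) => (3 * l + 2 - 2 * n, n)

theorem residueSplit_bijective : Function.Bijective residueSplit := by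
  constructor
  · rintro (⟨l, t⟩ | ⟨l, t⟩ | ⟨l, t⟩) (⟨l', t'⟩ | ⟨l', t'⟩ | ⟨l', t'⟩) h <;>
    simp only [residueSplit, Prod.mk.injEq] at h <;> simp only [Sum.inl.injEq, Sum.inr.injEq,
      Prod.mk.injEq, reduceCtorEq] <;> omega
  · rintro ⟨m, n⟩
    have : (m + 2 * n) % 3 = 0 ∨ (m + 2 * n) % 3 = 1 ∨ (m + 2 * n) % 3 = 2 := by omega
    rcases this with h | h | h
    · refine ⟨.inl (-(m + 2 * n) / 3, n + -(m + 2 * n) / 3), ?_⟩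
      exact Prod.ext (by dsimp only [residueSplit]; omega) (by dsimp only [residueSplit]; omega)
    · refine ⟨.inr (.inl ((m + 2 * n) / 3, (m + 2 * n) / 3 - n)), ?_⟩
      exact Prod.ext (by dsimp only [residueSplit]; omega) (by dsimp only [residueSplit]; omega)
    · refine ⟨.inr (.inr ((m + 2 * n) / 3, n)), ?_⟩
      exact Prod.ext (by dsimp only [residueSplit]; omega) rfl

theorem thetaSeries_negOnePow_triangular :
    thetaSeries (fun j : ℤ => (j.negOnePow : ℤ)) triangular = 0 := by
  refine thetaSeries_eq_zero_of_antisymm (Equiv.subLeft 1) (fun j => ?_) fun j => ?_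
  · simp [Int.negOnePow_sub]
  · have h1 := two_mul_triangular j
    have h2 := two_mul_triangular (1 - j)
    change triangular (1 - j) = triangular j
    zify; linarith

/-- The weight p.1 may be replaced by p.1 + 2 p.2 because the extra term carries the factor ∑ (-1)^j
q^(j(j-1)/2) = 0. The new weight depends on a single coordinate in each piece of `residueSplit`. -/
theorem jacobiSeries_mul_gaussSeries :
    jacobiSeries * gaussSeries =
      thetaSeries (fun p : ℤ × ℤ => ((p.1 + p.2).negOnePow : ℤ) * (p.1 + 2 * p.2))
        (fun p => triangular p.1 + (p.2 ^ 2).toNat) := by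
  have h1 := thetaSeries_mul (c := fun j : ℤ => (j.negOnePow : ℤ) * j)
    (c' := fun j : ℤ => (j.negOnePow : ℤ)) finite_setOf_triangular_le finite_setOf_sq_le
  have h2 := thetaSeries_mul (c := fun j : ℤ => (j.negOnePow : ℤ))
    (c' := fun j : ℤ => (j.negOnePow : ℤ) * (2 * j)) finite_setOf_triangular_le finite_setOf_sq_le
  rw [thetaSeries_negOnePow_triangular, zero_mul] at h2
  rw [jacobiSeries, gaussSeries, h1, ← add_zero (thetaSeries _ _), h2, ← thetaSeries_add
    (finite_setOf_add_le finite_setOf_triangular_le finite_setOf_sq_le)]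
  congr 1
  funext p
  rw [Int.negOnePow_add]
  push_cast
  ring

theorem negOnePow_eq_of_sub_even {a b : ℤ} (h : Even (a - b)) :
    (a.negOnePow : ℤ) = b.negOnePow := by
  rw [(Int.negOnePow_eq_iff a b).mpr h]

theorem negOnePow_eq_neg_of_sub_odd {a b : ℤ} (h : Odd (a - b)) :
    (a.negOnePow : ℤ) = -b.negOnePow := by
  have : Even (a - (b + 1)) := by
    rw [← sub_sub]; exact h.sub_odd odd_one
  rw [(Int.negOnePow_eq_iff a (b + 1)).mpr this, Int.negOnePow_succ]
  simp

/-- On this residue class the reflection n ↦ 2l + 1 - n keeps the exponent and the weight 3l + 2 but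
reverses the sign. -/
theorem thetaSeries_residueSplit_two :
    thetaSeries (fun p : ℤ × ℤ => ((3 * p.1 + 2 - 2 * p.2 + p.2).negOnePow : ℤ) *
      (3 * p.1 + 2 - 2 * p.2 + 2 * p.2))
      (fun p => triangular (3 * p.1 + 2 - 2 * p.2) + (p.2 ^ 2).toNat) = 0 := by
  let σ : ℤ × ℤ → ℤ × ℤ := fun p => (p.1, 2 * p.1 + 1 - p.2)
  have hσ : Function.Involutive σ := fun p => by ext <;> simp [σ]
  refine thetaSeries_eq_zero_of_antisymm hσ.toPerm (fun p => ?_) fun p => ?_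
  · simp only [Function.Involutive.coe_toPerm, σ]
    rw [negOnePow_eq_neg_of_sub_odd (b := 3 * p.1 + 2 - 2 * p.2 + p.2) ⟨p.2 - p.1 - 1, by ring⟩]
    ring
  · simp only [Function.Involutive.coe_toPerm, σ]
    have h1 := two_mul_triangular (3 * p.1 + 2 - 2 * p.2)
    have h2 := two_mul_triangular (3 * p.1 + 2 - 2 * (2 * p.1 + 1 - p.2))
    zify
    rw [Int.toNat_of_nonneg (sq_nonneg _), Int.toNat_of_nonneg (sq_nonneg _)]
    linarith

/-- The two surviving residue classes have the same exponent l(3l+1)/2 + t(3t+1), with signed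
weights -3l (-1)^t and -(3l+1) (-1)^t; these add up to -(6l+1) (-1)^t. -/
theorem jacobiSeries_mul_gaussSeries_eq :
    jacobiSeries * gaussSeries =
      -(linearPentagonalSeries * expand 2 two_ne_zero (pentagonalSeries ℤ)) := by
  have hfin := finite_setOf_add_le finite_setOf_pentagonal_neg_le
    finite_setOf_two_mul_pentagonal_neg_le
  have hfin' := finite_setOf_add_le finite_setOf_triangular_le finite_setOf_sq_le
  have hexp : ∀ (m n l t : ℤ), 2 * (m * (m - 1) + 2 * n ^ 2) =
      2 * (l * (3 * l + 1) + 2 * (t * (3 * t + 1))) →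
      triangular m + (n ^ 2).toNat = pentagonal (-l) + 2 * pentagonal (-t) := by
    intro m n l t h
    have h1 := two_mul_triangular m
    have h2 := two_mul_natCast_pentagonal_neg l
    have h3 := two_mul_natCast_pentagonal_neg t
    zify
    rw [Int.toNat_of_nonneg (sq_nonneg _)]
    linarith
  rw [jacobiSeries_mul_gaussSeries, ← thetaSeries_comp_equiv
    (Equiv.ofBijective _ residueSplit_bijective)]
  simp only [Equiv.ofBijective_apply]
  rw [thetaSeries_sum (fun n => Set.Finite.preimage (f := residueSplit)
      residueSplit_bijective.1.injOn (hfin' n)),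
    thetaSeries_sum (fun n => Set.Finite.preimage (f := fun k => residueSplit (Sum.inr k))
      (residueSplit_bijective.1.comp Sum.inr_injective).injOn (hfin' n))]
  simp only [residueSplit]
  rw [thetaSeries_residueSplit_two, add_zero, linearPentagonalSeries,
    pentagonalSeries_eq_thetaSeries, expand_thetaSeries, thetaSeries_mul
    finite_setOf_pentagonal_neg_le finite_setOf_two_mul_pentagonal_neg_le, ← thetaSeries_neg]
  have e1 : (fun p : ℤ × ℤ => triangular (-p.1 - 2 * p.2) + ((p.2 - p.1) ^ 2).toNat) =
      fun p => pentagonal (-p.1) + 2 * pentagonal (-p.2) :=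
    funext fun p => hexp _ _ _ _ (by ring)
  have e2 : (fun p : ℤ × ℤ => triangular (p.1 + 1 + 2 * p.2) + ((p.1 - p.2) ^ 2).toNat) =
      fun p => pentagonal (-p.1) + 2 * pentagonal (-p.2) :=
    funext fun p => hexp _ _ _ _ (by ring)
  rw [e1, e2, ← thetaSeries_add hfin]
  congr 1
  funext p
  rw [negOnePow_eq_of_sub_even (a := -p.1 - 2 * p.2 + (p.2 - p.1)) (b := p.2)
      ⟨-p.1 - p.2, by ring⟩,
    negOnePow_eq_neg_of_sub_odd (a := p.1 + 1 + 2 * p.2 + (p.1 - p.2)) (b := p.2)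
      ⟨p.1, by ring⟩]
  ring

/-- The weight `3/2` theta identity `f₁ φ² = ∑ (6 i + 1) q ^ (i (3 i + 1) / 2)`. -/
theorem pentagonalSeries_mul_gaussSeries_sq :
    pentagonalSeries ℤ * gaussSeries ^ 2 = linearPentagonalSeries := by
  have h1 := jacobiSeries_mul_gaussSeries_eq
  have h2 := gaussSeries_mul_expand_two
  rw [jacobiSeries_eq] at h1
  refine mul_right_cancel₀ (isUnit_expand_pentagonalSeries two_ne_zero).ne_zero ?_
  linear_combination pentagonalSeries ℤ * gaussSeries * h2 - h1

theorem exists_gaussSeries_eq : ∃ S : ℤ⟦X⟧, gaussSeries = 1 + 2 * S := by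
  refine exists_thetaSeries_eq_one_add_two_mul (fun j => ?_) (fun j => ?_) (by simp) fun j => ?_
  · simp
  · simp
  · rw [Int.toNat_eq_zero]
    constructor
    · intro h; nlinarith [sq_nonneg j, sq_eq_zero_iff.mp (le_antisymm h (sq_nonneg j))]
    · rintro rfl; simp

end Quintuple

/-! ### Distinct partitions and the reduction of DSOME modulo 8 -/

section Partitions

open PowerSeries.WithPiTopology

/-- The generating function of partitions into distinct parts, a partition being weighted by the
product of the values of `s` at its parts. -/
def distinctSeries (s : ℕ → ℤ) : ℤ⟦X⟧ :=
  .mk fun n => ∑ p ∈ Nat.Partition.distincts n, (p.parts.map s).prod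

theorem distinctSeries_eq_genFun (s : ℕ → ℤ) :
    distinctSeries s = Nat.Partition.genFun fun i c => if c = 1 then s i else 0 := by
  ext n
  rw [distinctSeries, coeff_mk, Nat.Partition.coeff_genFun, Nat.Partition.distincts,
    Finset.sum_filter]
  refine Finset.sum_congr rfl fun p _ => ?_
  rw [Finsupp.prod, Multiset.toFinsupp_support]
  split_ifs with h
  · have hp : p.parts = p.parts.toFinset.val := by
      rw [Multiset.toFinset_val, Multiset.dedup_eq_self.mpr h]
    conv_lhs => rw [hp]
    change ∏ i ∈ p.parts.toFinset, s i = _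
    refine Finset.prod_congr rfl fun i hi => ?_
    rw [Multiset.toFinsupp_apply, Multiset.count_eq_one_of_mem h (by simpa using hi), if_pos rfl]
  · rw [Multiset.nodup_iff_count_le_one] at h
    push Not at h
    obtain ⟨i, hi⟩ := h
    refine (Finset.prod_eq_zero (i := i) ?_ ?_).symm
    · rw [Multiset.mem_toFinset, ← Multiset.count_pos]; omega
    · rw [Multiset.toFinsupp_apply, if_neg (by omega)]

theorem hasProd_distinctSeries (s : ℕ → ℤ) :
    HasProd (fun i => 1 + C (s (i + 1)) * X ^ (i + 1)) (distinctSeries s) := by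
  rw [distinctSeries_eq_genFun]
  have h : (fun i => 1 + C (s (i + 1)) * (X : ℤ⟦X⟧) ^ (i + 1)) = fun i => 1 + ∑' j : ℕ,
      (if j + 1 = 1 then s (i + 1) else 0) • (X : ℤ⟦X⟧) ^ ((i + 1) * (j + 1)) := by
    funext i
    rw [tsum_eq_single 0]
    · simp
    · intro j hj
      simp [hj]
  rw [h]
  exact Nat.Partition.hasProd_genFun fun i c => if c = 1 then s i else 0

theorem continuous_expand {p : ℕ} (hp : p ≠ 0) :
    Continuous (expand p hp : ℤ⟦X⟧ →ₐ[ℤ] ℤ⟦X⟧) := by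
  rw [continuous_iff_continuousAt]
  intro f
  rw [ContinuousAt, tendsto_iff_coeff_tendsto]
  intro d
  simp_rw [coeff_expand]
  split_ifs
  · exact (continuous_coeff ℤ _).tendsto f
  · exact tendsto_const_nhds

theorem hasProd_expand_pentagonalSeries {p : ℕ} (hp : p ≠ 0) :
    HasProd (fun i => 1 - (X : ℤ⟦X⟧) ^ (p * (i + 1))) (expand p hp (pentagonalSeries ℤ)) := by
  have h := (hasProd_one_sub_X_pow ℤ).map (expand p hp : ℤ⟦X⟧ →ₐ[ℤ] ℤ⟦X⟧) (continuous_expand hp)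
  convert h using 1
  funext i
  simp [pow_mul]

/-- Padding with factors 1 puts f₄ and f₈ over the same index set as f₁, so that products can be
compared factor by factor. -/
theorem hasProd_ite_four_dvd {k : ℕ} (hk : 4 * k ≠ 0) :
    HasProd (fun i => if 4 ∣ i + 1 then 1 - (X : ℤ⟦X⟧) ^ (k * (i + 1)) else 1)
      (expand (4 * k) hk (pentagonalSeries ℤ)) := by
  have hinj : Function.Injective fun i : ℕ => 4 * i + 3 := fun a b h => by
    simp only at h; omega
  rw [← hinj.hasProd_iff]
  · convert hasProd_expand_pentagonalSeries hk using 1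
    funext i
    have : 4 ∣ 4 * i + 3 + 1 := ⟨i + 1, by ring⟩
    simp only [Function.comp_apply, if_pos this]
    ring
  · intro i hi
    rw [if_neg]
    rintro ⟨j, hj⟩
    exact hi ⟨j - 1, by simp only; omega⟩

theorem distinctSeries_one_mul_pentagonalSeries :
    distinctSeries (fun _ => 1) * pentagonalSeries ℤ =
      expand 2 two_ne_zero (pentagonalSeries ℤ) := by
  have h := (hasProd_distinctSeries fun _ => 1).mul (hasProd_one_sub_X_pow ℤ)
  refine h.unique ?_
  convert hasProd_expand_pentagonalSeries two_ne_zero using 1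
  funext i
  simp only [map_one]
  ring

/-- The sign recording whether a part fails to be divisible by `4`. -/
def fourSign (k : ℕ) : ℤ := if 4 ∣ k then 1 else -1

/-- For 4 ∣ i the factor identity is (1 + X^i)(1 - X^i)² = (1 - X^i)(1 - X^(2i)); for other i the
factor is already 1 - X^i. -/
theorem distinctSeries_fourSign_mul :
    distinctSeries fourSign * expand 4 four_ne_zero (pentagonalSeries ℤ) ^ 2 =
      pentagonalSeries ℤ * expand 4 four_ne_zero (expand 2 two_ne_zero (pentagonalSeries ℤ)) := by
  rw [← expand_mul 4 four_ne_zero 2 two_ne_zero, sq]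
  have h4 := hasProd_ite_four_dvd (k := 1) (by norm_num)
  have h8 := hasProd_ite_four_dvd (k := 2) (by norm_num)
  have h1 := (hasProd_distinctSeries fourSign).mul (h4.mul h4)
  refine h1.unique ?_
  convert (hasProd_one_sub_X_pow ℤ).mul h8 using 1
  funext i
  rw [fourSign]
  split_ifs
  · simp only [map_one]; ring
  · simp only [map_neg, map_one]; ring

/-- Adding a part a changes (left side) + 3 · sum by 4a if a is odd and by 2a if a is even. Modulo 8
this is 0 when 4 ∣ a and 4 otherwise, which is exactly the effect of a sign change in 2 · (±1). -/
theorem multiset_odd_sub_even_modEq (m : Multiset ℕ) :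
    ((m.filter fun k => Odd k).sum : ℤ) - (m.filter fun k => Even k).sum ≡
        2 - 3 * m.sum - 2 * (m.map fourSign).prod [ZMOD 8] ∧
      ((m.map fourSign).prod = 1 ∨ (m.map fourSign).prod = -1) := by
  induction m using Multiset.induction with
  | empty => simp
  | cons a m ih =>
    obtain ⟨h, hP⟩ := ih
    rw [Multiset.map_cons, Multiset.prod_cons, Multiset.sum_cons, fourSign]
    rcases Nat.even_or_odd a with ha | ha
    · rw [Multiset.filter_cons_of_neg (p := fun k => Odd k) _ (by simpa using ha),
        Multiset.filter_cons_of_pos (p := fun k => Even k) _ ha,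
        Multiset.sum_cons]
      rw [Nat.even_iff] at ha
      unfold Int.ModEq at h ⊢
      rw [Nat.cast_add, Nat.cast_add]
      split_ifs with h4
      · refine ⟨?_, by simpa using hP⟩
        omega
      · refine ⟨?_, by omega⟩
        rcases hP with hP | hP <;> rw [hP] at h ⊢ <;> omega
    · have h4 : ¬4 ∣ a := by rw [Nat.odd_iff] at ha; omega
      rw [Multiset.filter_cons_of_pos (p := fun k => Odd k) _ ha,
        Multiset.filter_cons_of_neg (p := fun k => Even k) _ (by simpa using ha),
        Multiset.sum_cons, if_neg h4]
      rw [Nat.odd_iff] at ha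
      unfold Int.ModEq at h ⊢
      rw [Nat.cast_add, Nat.cast_add]
      refine ⟨?_, by omega⟩
      rcases hP with hP | hP <;> rw [hP] at h ⊢ <;> omega

theorem DSOME_modEq_distinctSeries (n : ℕ) :
    DSOME n ≡ (2 - 3 * n) * (distinctSeries fun _ => 1).coeff n -
      2 * (distinctSeries fourSign).coeff n [ZMOD 8] := by
  have h : (2 - 3 * n) * (distinctSeries fun _ => 1).coeff n -
      2 * (distinctSeries fourSign).coeff n = ∑ p ∈ Nat.Partition.distincts n,
        (2 - 3 * (p.parts.sum : ℤ) - 2 * (p.parts.map fourSign).prod) := by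
    rw [distinctSeries, distinctSeries, coeff_mk, coeff_mk, Finset.mul_sum, Finset.mul_sum,
      ← Finset.sum_sub_distrib]
    refine Finset.sum_congr rfl fun p _ => ?_
    rw [p.parts_sum]
    simp
  rw [h, DSOME, ← Finset.sum_sub_distrib]
  exact Int.ModEq.sum fun p _ => (multiset_odd_sub_even_modEq p.parts).1

end Partitions

/-! ### DSOME modulo 8 as sums over a binary quadratic form -/

section LatticeSums

/-- The exponent `i (3 i + 1) / 2 + j ^ 2`. -/
def latticeExp (p : ℤ × ℤ) : ℕ := pentagonal (-p.1) + (p.2 ^ 2).toNat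

theorem finite_setOf_latticeExp_le (n : ℕ) : {p : ℤ × ℤ | latticeExp p ≤ n}.Finite :=
  finite_setOf_add_le finite_setOf_pentagonal_neg_le finite_setOf_sq_le n

/-- The sum of `w` over the `(i, j)` with `i (3 i + 1) / 2 + j ^ 2 = n`. -/
noncomputable def latticeSum (w : ℤ × ℤ → ℤ) (n : ℕ) : ℤ :=
  ∑ᶠ p, if latticeExp p = n then w p else 0

theorem coeff_thetaSeries_latticeExp (w : ℤ × ℤ → ℤ) (n : ℕ) :
    (thetaSeries w latticeExp).coeff n = latticeSum w n := coeff_thetaSeries _ _ _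

theorem distinctSeries_one_mul_gaussSeries :
    distinctSeries (fun _ => 1) * gaussSeries = pentagonalSeries ℤ := by
  have h1 := distinctSeries_one_mul_pentagonalSeries
  have h2 := gaussSeries_mul_expand_two
  refine mul_right_cancel₀ pentagonalSeries_ne_zero ?_
  linear_combination gaussSeries * h1 + h2

theorem distinctSeries_fourSign_mul_expand_gaussSeries :
    distinctSeries fourSign * expand 4 four_ne_zero gaussSeries = pentagonalSeries ℤ := by
  have h1 := distinctSeries_fourSign_mul
  have h2 := congrArg (expand 4 four_ne_zero) gaussSeries_mul_expand_two
  rw [map_mul, map_pow] at h2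
  refine mul_right_cancel₀ ((isUnit_expand_pentagonalSeries two_ne_zero).map
    (expand 4 four_ne_zero)).ne_zero ?_
  linear_combination h1 + distinctSeries fourSign * h2

theorem exists_distinctSeries_one_eq :
    ∃ R, distinctSeries (fun _ => 1) = thetaSeries
      (fun p : ℤ × ℤ => (6 * p.1 + 1) * (p.2.negOnePow : ℤ)) latticeExp + 8 * R := by
  obtain ⟨S, hS⟩ := exists_gaussSeries_eq
  have h1 := distinctSeries_one_mul_gaussSeries
  have h2 := pentagonalSeries_mul_gaussSeries_sq
  have h3 := thetaSeries_mul (c := fun i : ℤ => 6 * i + 1)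
    (c' := fun j : ℤ => (j.negOnePow : ℤ)) finite_setOf_pentagonal_neg_le finite_setOf_sq_le
  rw [← linearPentagonalSeries, ← gaussSeries] at h3
  change _ = thetaSeries _ latticeExp at h3
  rw [← h3, ← h2, ← h1]
  set Q := distinctSeries fun _ => 1
  rw [hS]
  -- The goal is now Q = Q φ⁴ + 8R with φ = 1 + 2S; the bracket is (φ⁴ - 1)/8.
  exact ⟨-Q * (S + 3 * S ^ 2 + 4 * S ^ 3 + 2 * S ^ 4), by ring⟩

/-- The right-hand theta series lives on even j and equals 2 ∑ q^(4k²). The difference is -4 times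
the sum of q^(4k²) over odd k, whose coefficients are even by k ↦ -k. This gives all three weights
the common exponent `latticeExp`. -/
theorem exists_expand_four_gaussSeries_eq :
    ∃ S, 2 * expand 4 four_ne_zero gaussSeries =
      thetaSeries (fun j : ℤ => 1 + (j.negOnePow : ℤ)) (fun j => (j ^ 2).toNat) + 8 * S := by
  have h : ∀ n, ∃ a, 2 * (expand 4 four_ne_zero gaussSeries).coeff n =
      (thetaSeries (fun j : ℤ => 1 + (j.negOnePow : ℤ)) (fun j => (j ^ 2).toNat)).coeff n +
        8 * a := by
    intro n
    rw [gaussSeries, expand_thetaSeries, coeff_thetaSeries, coeff_thetaSeries]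
    have hinj : Function.Injective fun j : ℤ => 2 * j := fun a b h => by
      simp only at h; omega
    have hsupp : (Function.support fun j : ℤ => if (j ^ 2).toNat = n then
        1 + (j.negOnePow : ℤ) else 0) ⊆ Set.range fun j : ℤ => 2 * j := by
      intro j hj
      rcases Int.even_or_odd j with ⟨k, hk⟩ | ho
      · exact ⟨k, by simp only; omega⟩
      · simp [Int.negOnePow_odd j ho] at hj
    have hrange := finsum_mem_range (f := fun j : ℤ => if (j ^ 2).toNat = n then
      1 + (j.negOnePow : ℤ) else 0) hinj
    rw [finsum_mem_def, Set.indicator_eq_self.mpr hsupp] at hrange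
    rw [hrange]
    obtain ⟨a, ha⟩ := two_dvd_finsum_of_involutive
      (f := fun j : ℤ => if 4 * (j ^ 2).toNat = n ∧ Odd j then (1 : ℤ) else 0)
      (fun j : ℤ => -j) neg_involutive (by simp) (by
        intro j hj
        have hj0 : j = 0 := by omega
        subst hj0
        simp)
    refine ⟨-a, ?_⟩
    have hfin : ∀ g : ℤ → ℤ, (Function.support fun j : ℤ =>
        if 4 * (j ^ 2).toNat = n then g j else 0) ⊆ (finite_setOf_sq_le n).toFinset := by
      intro g j hj
      simp only [Function.mem_support, ne_eq, ite_eq_right_iff, Classical.not_imp] at hj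
      simp only [Set.Finite.coe_toFinset, Set.mem_ofPred_eq]
      omega
    rw [show 8 * -a = -4 * (2 * a) by ring, ← ha]
    have e1 : ∀ j : ℤ, ((2 * j) ^ 2).toNat = 4 * (j ^ 2).toNat := by
      intro j
      zify
      rw [Int.toNat_of_nonneg (sq_nonneg _), Int.toNat_of_nonneg (sq_nonneg _)]
      ring
    simp only [e1, ite_and]
    rw [finsum_eq_sum_of_support_subset _ (hfin _), finsum_eq_sum_of_support_subset _ (hfin _),
      finsum_eq_sum_of_support_subset _ (hfin _), Finset.mul_sum, Finset.mul_sum,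
      ← Finset.sum_add_distrib]
    refine Finset.sum_congr rfl fun j _ => ?_
    rcases Int.even_or_odd j with hj | hj
    · simp [Int.negOnePow_even j hj, Int.not_odd_iff_even.mpr hj]
    · simp only [Int.negOnePow_odd j hj, hj, if_true, Int.negOnePow_even (2 * j) (by simp)]
      split_ifs <;> simp
  choose a ha using h
  refine ⟨.mk a, ?_⟩
  ext n
  rw [map_add, ← map_ofNat (C (R := ℤ)) 8, ← map_ofNat (C (R := ℤ)) 2, coeff_C_mul, coeff_C_mul,
    coeff_mk, ha n]

theorem exists_two_mul_distinctSeries_sub_eq :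
    ∃ R, 2 * distinctSeries (fun _ => 1) - 2 * distinctSeries fourSign =
      thetaSeries (fun p : ℤ × ℤ => ((p.1 + p.2).negOnePow : ℤ)) latticeExp -
        thetaSeries (fun p : ℤ × ℤ => (p.1.negOnePow : ℤ)) latticeExp + 8 * R := by
  obtain ⟨S, hS⟩ := exists_gaussSeries_eq
  obtain ⟨T, hT⟩ := exists_expand_four_gaussSeries_eq
  have hS4 := congrArg (expand 4 four_ne_zero) hS
  rw [map_add, map_mul, map_one, map_ofNat] at hS4
  have h1 := distinctSeries_one_mul_gaussSeries
  have h2 := distinctSeries_fourSign_mul_expand_gaussSeries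
  have h3 := thetaSeries_mul (c := fun i : ℤ => (i.negOnePow : ℤ))
    (c' := fun j : ℤ => (j.negOnePow : ℤ)) finite_setOf_pentagonal_neg_le finite_setOf_sq_le
  have h4 := thetaSeries_mul (c := fun i : ℤ => (i.negOnePow : ℤ))
    (c' := fun j : ℤ => 1 + (j.negOnePow : ℤ)) finite_setOf_pentagonal_neg_le finite_setOf_sq_le
  rw [← pentagonalSeries_eq_thetaSeries, ← gaussSeries] at h3
  rw [← pentagonalSeries_eq_thetaSeries] at h4
  have e1 : (fun p : ℤ × ℤ => (p.1.negOnePow : ℤ) * (p.2.negOnePow : ℤ)) =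
      fun p => ((p.1 + p.2).negOnePow : ℤ) := by
    funext p; rw [Int.negOnePow_add]; push_cast; rfl
  have e2 : (fun p : ℤ × ℤ => (p.1.negOnePow : ℤ) * (1 + (p.2.negOnePow : ℤ))) =
      fun p => (p.1.negOnePow : ℤ) + ((p.1 + p.2).negOnePow : ℤ) := by
    funext p; rw [Int.negOnePow_add]; push_cast; ring
  rw [e1] at h3
  rw [e2] at h4
  change _ = thetaSeries _ latticeExp at h3
  change _ = thetaSeries _ latticeExp at h4
  rw [thetaSeries_add finite_setOf_latticeExp_le] at h4
  set Q := distinctSeries fun _ => 1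
  set Q' := distinctSeries fourSign
  set φ := gaussSeries
  set φ' := expand 4 four_ne_zero gaussSeries
  set S' := expand 4 four_ne_zero S
  set E := pentagonalSeries ℤ
  refine ⟨-Q * (S + S ^ 2) + Q' * (S' + S' ^ 2) - E * T, ?_⟩
  have hq : φ ^ 2 - 1 = 4 * (S + S ^ 2) := by rw [hS]; ring
  have hq' : φ' ^ 2 - 1 = 4 * (S' + S' ^ 2) := by rw [hS4]; ring
  linear_combination -2 * Q * hq + 2 * Q' * hq' + 2 * φ * h1 - 2 * φ' * h2 - E * hT + 2 * h3 - h4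

theorem DSOME_modEq_latticeSum (n : ℕ) :
    DSOME n ≡ -3 * n * latticeSum (fun p => (6 * p.1 + 1) * (p.2.negOnePow : ℤ)) n +
      (latticeSum (fun p => ((p.1 + p.2).negOnePow : ℤ)) n -
        latticeSum (fun p => (p.1.negOnePow : ℤ)) n) [ZMOD 8] := by
  refine (DSOME_modEq_distinctSeries n).trans ?_
  obtain ⟨R, hR⟩ := exists_distinctSeries_one_eq
  obtain ⟨R', hR'⟩ := exists_two_mul_distinctSeries_sub_eq
  have h1 := congrArg (coeff n) hR
  have h2 := congrArg (coeff n) hR'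
  rw [map_add, ← map_ofNat (C (R := ℤ)) 8, coeff_C_mul, coeff_thetaSeries_latticeExp] at h1
  rw [map_add, map_sub, map_sub, ← map_ofNat (C (R := ℤ)) 8, ← map_ofNat (C (R := ℤ)) 2,
    coeff_C_mul, coeff_C_mul, coeff_C_mul, coeff_thetaSeries_latticeExp,
    coeff_thetaSeries_latticeExp] at h2
  refine (Int.modEq_iff_dvd.mpr ⟨3 * n * R.coeff n - R'.coeff n, ?_⟩)
  linear_combination 3 * n * h1 - h2

end LatticeSums

/-! ### Hecke recursion at 5 and the final congruence -/

section Recurrence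

theorem latticeExp_eq_iff (p : ℤ × ℤ) (n : ℕ) :
    latticeExp p = n ↔ (6 * p.1 + 1) ^ 2 + 24 * p.2 ^ 2 = 24 * (n : ℤ) + 1 := by
  have h1 := two_mul_natCast_pentagonal_neg p.1
  have h2 : ((p.2 ^ 2).toNat : ℤ) = p.2 ^ 2 := Int.toNat_of_nonneg (sq_nonneg _)
  rw [latticeExp]
  zify
  rw [h2]
  constructor <;> intro h <;> linarith

/-- The solutions `(i, j)` of `i (3 i + 1) / 2 + j ^ 2 = n`. -/
noncomputable def latticePoints (n : ℕ) : Finset (ℤ × ℤ) :=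
  (finite_setOf_latticeExp_le n).toFinset.filter fun p => latticeExp p = n

theorem mem_latticePoints {p : ℤ × ℤ} {n : ℕ} :
    p ∈ latticePoints n ↔ (6 * p.1 + 1) ^ 2 + 24 * p.2 ^ 2 = 24 * (n : ℤ) + 1 := by
  rw [← latticeExp_eq_iff, latticePoints, Finset.mem_filter, Set.Finite.mem_toFinset,
    Set.mem_ofPred_eq]
  exact ⟨fun h => h.2, fun h => ⟨h.le, h⟩⟩

theorem latticeSum_eq_sum (w : ℤ × ℤ → ℤ) (n : ℕ) :
    latticeSum w n = ∑ p ∈ latticePoints n, w p := by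
  rw [← coeff_thetaSeries_latticeExp, coeff_thetaSeries_eq_sum _ _
    (s := (finite_setOf_latticeExp_le n).toFinset) (by simp +contextual), latticePoints,
    Finset.sum_filter]

/-- Multiplication by `1 + 2 √-6`, in the coordinates `6 i + 1 + 2 j √-6`. -/
def latticeMul (p : ℤ × ℤ) : ℤ × ℤ := (p.1 - 4 * p.2, 6 * p.1 + 1 + p.2)

/-- Multiplication by `1 - 2 √-6`, in the coordinates `6 i + 1 + 2 j √-6`. -/
def latticeMulConj (p : ℤ × ℤ) : ℤ × ℤ := (p.1 + 4 * p.2, p.2 - 6 * p.1 - 1)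

/-- Multiplication by `25`, in the coordinates `6 i + 1 + 2 j √-6`. -/
def latticeScale (p : ℤ × ℤ) : ℤ × ℤ := (25 * p.1 + 4, 25 * p.2)

theorem latticeMul_injective : Function.Injective latticeMul := by
  rintro ⟨i, j⟩ ⟨i', j'⟩ h
  simp only [latticeMul, Prod.mk.injEq] at h ⊢
  omega

theorem latticeMulConj_injective : Function.Injective latticeMulConj := by
  rintro ⟨i, j⟩ ⟨i', j'⟩ h
  simp only [latticeMulConj, Prod.mk.injEq] at h ⊢
  omega

theorem latticeScale_injective : Function.Injective latticeScale := by
  rintro ⟨i, j⟩ ⟨i', j'⟩ h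
  simp only [latticeScale, Prod.mk.injEq] at h ⊢
  omega

/-- With x = 6i+1, (x + 2j√-6)(1 - 2√-6) = (x + 24j) + 2(j - x)√-6. Both coordinates are divisible
by 25 exactly when 25 ∣ j - x, and dividing by 25 gives the preimage. -/
theorem mem_image_latticeMul {p : ℤ × ℤ} {m : ℕ} (hp : p ∈ latticePoints (125 * m + 26)) :
    p ∈ (latticePoints (5 * m + 1)).image latticeMul ↔ 25 ∣ p.2 - (6 * p.1 + 1) := by
  obtain ⟨i, j⟩ := p
  simp only [Finset.mem_image, mem_latticePoints, latticeMul, Prod.mk.injEq, Prod.exists] at hp ⊢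
  constructor
  · rintro ⟨a, b, -, h1, h2⟩
    exact ⟨b, by omega⟩
  · rintro ⟨b, hb⟩
    refine ⟨i + 4 * b, b, ?_, by ring, by linarith⟩
    obtain rfl : j = 6 * i + 1 + 25 * b := by linarith
    push_cast at hp ⊢
    linarith

theorem mem_image_latticeMulConj {p : ℤ × ℤ} {m : ℕ} (hp : p ∈ latticePoints (125 * m + 26)) :
    p ∈ (latticePoints (5 * m + 1)).image latticeMulConj ↔ 25 ∣ p.2 + (6 * p.1 + 1) := by
  obtain ⟨i, j⟩ := p
  simp only [Finset.mem_image, mem_latticePoints, latticeMulConj, Prod.mk.injEq,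
    Prod.exists] at hp ⊢
  constructor
  · rintro ⟨a, b, -, h1, h2⟩
    exact ⟨b, by omega⟩
  · rintro ⟨b, hb⟩
    refine ⟨i - 4 * b, b, ?_, by ring, by linarith⟩
    obtain rfl : j = 25 * b - (6 * i + 1) := by linarith
    push_cast at hp ⊢
    linarith

/-- Modulo 25 the form is x² - y². If 5 divides only one of y ± x, that one takes the whole 25; if 5
divides both, the third factor 5 in 125 decides after dividing x and y by 5. -/
theorem dvd_sub_or_dvd_add_of_sq_add {x y k : ℤ} (h : x ^ 2 + 24 * y ^ 2 = 125 * k) :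
    25 ∣ y - x ∨ 25 ∣ y + x := by
  have h5 : Prime (5 : ℤ) := Int.prime_iff_natAbs_prime.mpr (by norm_num)
  have hprod : (25 : ℤ) ∣ (y - x) * (y + x) := ⟨y ^ 2 - 5 * k, by linarith⟩
  have hcop : ∀ a : ℤ, ¬5 ∣ a → IsCoprime (25 : ℤ) a := fun a ha => by
    have : IsCoprime ((5 : ℤ) ^ 2) a := ((h5.coprime_iff_not_dvd).mpr ha).pow_left
    norm_num at this
    exact this
  by_cases h1 : (5 : ℤ) ∣ y - x
  · by_cases h2 : (5 : ℤ) ∣ y + x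
    · obtain ⟨a, rfl⟩ : (5 : ℤ) ∣ x := by omega
      obtain ⟨b, rfl⟩ : (5 : ℤ) ∣ y := by omega
      have : (5 : ℤ) ∣ (b - a) * (b + a) := ⟨5 * b ^ 2 - k, by linarith⟩
      rcases h5.dvd_or_dvd this with h | h
      · left; omega
      · right; omega
    · exact .inl ((hcop _ h2).dvd_of_dvd_mul_right hprod)
  · exact .inr ((hcop _ h1).dvd_of_dvd_mul_left hprod)

theorem image_latticeMul_union_image_latticeMulConj (m : ℕ) :
    (latticePoints (5 * m + 1)).image latticeMul ∪
      (latticePoints (5 * m + 1)).image latticeMulConj = latticePoints (125 * m + 26) := by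
  ext p
  constructor
  · intro hp
    rcases Finset.mem_union.mp hp with h | h <;> obtain ⟨⟨i, j⟩, hq, rfl⟩ := Finset.mem_image.mp h
    all_goals
      rw [mem_latticePoints] at hq ⊢
      simp only [latticeMul, latticeMulConj] at hq ⊢
      push_cast at hq ⊢
      linarith
  · intro hp
    rw [Finset.mem_union, mem_image_latticeMul hp, mem_image_latticeMulConj hp]
    rw [mem_latticePoints] at hp
    refine dvd_sub_or_dvd_add_of_sq_add (k := 24 * m + 5) ?_
    push_cast at hp
    linarith

/-- Being divisible by both 1 + 2√-6 and 1 - 2√-6 amounts here to being divisible by their product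
25, which forces 5 ∣ m. -/
theorem image_latticeMul_inter_image_latticeMulConj (m : ℕ) :
    (latticePoints (5 * m + 1)).image latticeMul ∩
      (latticePoints (5 * m + 1)).image latticeMulConj =
      if 5 ∣ m then (latticePoints (m / 5)).image latticeScale else ∅ := by
  have key : ∀ p, p ∈ (latticePoints (5 * m + 1)).image latticeMul ∩
      (latticePoints (5 * m + 1)).image latticeMulConj ↔
      p ∈ latticePoints (125 * m + 26) ∧ 25 ∣ p.2 - (6 * p.1 + 1) ∧ 25 ∣ p.2 + (6 * p.1 + 1) := by
    intro p
    constructor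
    · intro h
      have hp : p ∈ latticePoints (125 * m + 26) := by
        rw [← image_latticeMul_union_image_latticeMulConj]
        exact Finset.mem_union_left _ (Finset.mem_inter.mp h).1
      rw [Finset.mem_inter, mem_image_latticeMul hp, mem_image_latticeMulConj hp] at h
      exact ⟨hp, h⟩
    · rintro ⟨hp, h⟩
      rwa [Finset.mem_inter, mem_image_latticeMul hp, mem_image_latticeMulConj hp]
  ext p
  rw [key]
  constructor
  · obtain ⟨i, j⟩ := p
    rintro ⟨hp, h1, h2⟩
    simp only at h1 h2
    rw [mem_latticePoints] at hp
    -- 25 divides 6i + 1, and 6 · 4 + 1 = 25.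
    obtain ⟨a, rfl⟩ : ∃ a, i = 25 * a + 4 := ⟨(i - 4) / 25, by omega⟩
    obtain ⟨b, rfl⟩ : (25 : ℤ) ∣ j := by omega
    have hm : 5 * ((6 * a + 1) ^ 2 + 24 * b ^ 2) = 24 * (m : ℤ) + 5 := by
      push_cast at hp
      linarith
    have h5 : 5 ∣ m := by omega
    rw [if_pos h5]
    obtain ⟨k, rfl⟩ := h5
    rw [Nat.mul_div_cancel_left _ (by norm_num)]
    refine Finset.mem_image.mpr ⟨(a, b), ?_, rfl⟩
    rw [mem_latticePoints]
    push_cast at hm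
    linarith
  · intro hp
    split_ifs at hp with h5
    · obtain ⟨k, rfl⟩ := h5
      rw [Nat.mul_div_cancel_left _ (by norm_num)] at hp
      obtain ⟨⟨a, b⟩, hq, rfl⟩ := Finset.mem_image.mp hp
      rw [mem_latticePoints] at hq ⊢
      simp only [latticeScale] at hq ⊢
      refine ⟨?_, by omega, by omega⟩
      push_cast
      linarith
    · simp at hp

/-- The value of `f` at `m / 5`, read as `0` when `m / 5` is not an integer. -/
def divFive (f : ℕ → ℤ) (m : ℕ) : ℤ := if 5 ∣ m then f (m / 5) else 0

/-- The Hecke recursion at the prime `5`. -/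
theorem latticeSum_recurrence {w : ℤ × ℤ → ℤ} {c e : ℤ}
    (hmul : ∀ p, w (latticeMul p) + w (latticeMulConj p) = c * w p)
    (hscale : ∀ p, w (latticeScale p) = e * w p) (m : ℕ) :
    latticeSum w (125 * m + 26) = c * latticeSum w (5 * m + 1) - e * divFive (latticeSum w) m := by
  have h := Finset.sum_union_inter (f := w) (s₁ := (latticePoints (5 * m + 1)).image latticeMul)
    (s₂ := (latticePoints (5 * m + 1)).image latticeMulConj)
  rw [image_latticeMul_union_image_latticeMulConj, image_latticeMul_inter_image_latticeMulConj,
    Finset.sum_image latticeMul_injective.injOn, Finset.sum_image latticeMulConj_injective.injOn,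
    ← Finset.sum_add_distrib, Finset.sum_congr rfl fun p _ => hmul p, ← Finset.mul_sum,
    ← latticeSum_eq_sum, ← latticeSum_eq_sum] at h
  rw [← h, divFive]
  split_ifs
  · rw [Finset.sum_image latticeScale_injective.injOn, Finset.sum_congr rfl fun p _ => hscale p,
      ← Finset.mul_sum, ← latticeSum_eq_sum]
    ring
  · simp

theorem divFive_twentyFive_mul_add_five (f : ℕ → ℤ) (m : ℕ) :
    divFive f (25 * m + 5) = f (5 * m + 1) := by
  rw [divFive, if_pos ⟨5 * m + 1, by ring⟩]
  congr 1
  omega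

theorem latticeSum_recurrence' {w : ℤ × ℤ → ℤ} {c e : ℤ}
    (hmul : ∀ p, w (latticeMul p) + w (latticeMulConj p) = c * w p)
    (hscale : ∀ p, w (latticeScale p) = e * w p) (m : ℕ) :
    latticeSum w (3125 * m + 651) =
      c * latticeSum w (125 * m + 26) - e * latticeSum w (5 * m + 1) := by
  have h := latticeSum_recurrence hmul hscale (25 * m + 5)
  rwa [divFive_twentyFive_mul_add_five, show 125 * (25 * m + 5) + 26 = 3125 * m + 651 by ring,
    show 5 * (25 * m + 5) + 1 = 125 * m + 26 by ring] at h

/-- The number 5m + 1 is pentagonal exactly when 5 ∣ m and m / 5 is pentagonal, and nonzero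
coefficients are ±1. Indeed k(3k-1) - 2 ≡ 3(k-1)² mod 5, so k = 5l + 1. -/
theorem two_dvd_coeff_pentagonalSeries_sub (m : ℕ) :
    2 ∣ (pentagonalSeries ℤ).coeff (5 * m + 1) -
      divFive (fun k => (pentagonalSeries ℤ).coeff k) m := by
  have hodd : ∀ a b : ℤ, (2 : ℤ) ∣ (a.negOnePow : ℤ) - b.negOnePow := by
    intro a b
    rcases Int.even_or_odd a with ha | ha <;> rcases Int.even_or_odd b with hb | hb <;>
      simp [ha, hb, Int.negOnePow_even, Int.negOnePow_odd]
  by_cases hn : 5 * m + 1 ∈ Set.range pentagonal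
  · obtain ⟨k, hk⟩ := hn
    have h := two_mul_natCast_pentagonal k
    rw [hk] at h
    push_cast at h
    have h5 : (5 : ℤ) ∣ (k - 1) * (k - 1) :=
      ⟨4 * m - 2 * (k - 1) - (k - 1) ^ 2, by linear_combination -2 * h⟩
    obtain ⟨l, hl⟩ : (5 : ℤ) ∣ k - 1 :=
      or_self_iff.mp ((Int.prime_iff_natAbs_prime.mpr (by norm_num)).dvd_or_dvd h5)
    obtain rfl : k = 5 * l + 1 := by linarith
    have hm : 2 * (m : ℤ) = 5 * (l * (3 * l + 1)) := by linarith
    obtain ⟨n, rfl⟩ : 5 ∣ m := by omega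
    have hl' := two_mul_natCast_pentagonal_neg l
    have hn : pentagonal (-l) = n := by
      push_cast at hm
      zify
      linarith
    rw [divFive, if_pos ⟨n, rfl⟩, Nat.mul_div_cancel_left _ (by norm_num), ← hk, ← hn,
      coeff_pentagonalSeries_pentagonal, coeff_pentagonalSeries_pentagonal]
    exact hodd (5 * l + 1) (-l)
  · rw [coeff_pentagonalSeries_eq_zero ℤ hn, divFive]
    split_ifs with h5
    · obtain ⟨n, rfl⟩ := h5
      rw [Nat.mul_div_cancel_left _ (by norm_num), coeff_pentagonalSeries_eq_zero]
      · simp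
      · rintro ⟨l, hl⟩
        refine hn ⟨1 - 5 * l, ?_⟩
        have h1 := two_mul_natCast_pentagonal l
        have h2 := two_mul_natCast_pentagonal (1 - 5 * l)
        rw [hl] at h1
        zify
        linarith
    · simp

/-- The weight ignores j, so the generating series is f₁ ∑ q^(j²), and ∑ q^(j²) ≡ 1 mod 2. -/
theorem two_dvd_latticeSum_sub_coeff (n : ℕ) :
    2 ∣ latticeSum (fun p => (p.1.negOnePow : ℤ)) n - (pentagonalSeries ℤ).coeff n := by
  obtain ⟨S, hS⟩ := exists_thetaSeries_eq_one_add_two_mul (c := fun _ : ℤ => 1)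
    (e := fun j : ℤ => (j ^ 2).toNat) (by simp) (by simp) rfl fun j => by
      rw [Int.toNat_eq_zero, sq_nonpos_iff]
  have h := thetaSeries_mul (c := fun i : ℤ => (i.negOnePow : ℤ)) (c' := fun _ : ℤ => 1)
    finite_setOf_pentagonal_neg_le finite_setOf_sq_le
  rw [← pentagonalSeries_eq_thetaSeries, hS] at h
  simp only [mul_one] at h
  change _ = thetaSeries _ latticeExp at h
  rw [← coeff_thetaSeries_latticeExp, ← h, ← map_sub]
  refine ⟨(pentagonalSeries ℤ * S).coeff n, ?_⟩
  rw [← coeff_C_mul, map_ofNat]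
  congr 1
  ring

theorem two_dvd_latticeSum_sub_divFive (m : ℕ) :
    2 ∣ latticeSum (fun p => (p.1.negOnePow : ℤ)) (5 * m + 1) -
      divFive (latticeSum fun p => (p.1.negOnePow : ℤ)) m := by
  have h1 := two_dvd_latticeSum_sub_coeff (5 * m + 1)
  have h2 := two_dvd_latticeSum_sub_coeff (m / 5)
  have h3 := two_dvd_coeff_pentagonalSeries_sub m
  rw [divFive] at h3 ⊢
  split_ifs at h3 ⊢ <;> omega

theorem DSOME_recurrence_modEq (m : ℕ) :
    DSOME (3125 * m + 651) ≡
      5 * DSOME (5 * m + 1) + DSOME (125 * m + 26) - 5 * divFive DSOME m [ZMOD 8] := by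
  set B : ℤ × ℤ → ℤ := fun p => (6 * p.1 + 1) * (p.2.negOnePow : ℤ) with hB
  set wq : ℤ × ℤ → ℤ := fun p => ((p.1 + p.2).negOnePow : ℤ) with hwq
  set wp : ℤ × ℤ → ℤ := fun p => (p.1.negOnePow : ℤ) with hwp
  have hD : ∀ n, DSOME n ≡ -3 * n * latticeSum B n + (latticeSum wq n - latticeSum wp n) [ZMOD 8] :=
    DSOME_modEq_latticeSum
  have hD0 : divFive DSOME m ≡ -3 * (5 * m) * divFive (latticeSum B) m +
      (divFive (latticeSum wq) m - divFive (latticeSum wp) m) [ZMOD 8] := by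
    simp only [divFive]
    split_ifs with h5
    · obtain ⟨k, rfl⟩ := h5
      rw [Nat.mul_div_cancel_left _ (by norm_num)]
      -- The factor k = m/5 may be written 5m = 25k, since 25 ≡ 1 mod 8.
      refine (hD k).trans (Int.modEq_iff_dvd.mpr ⟨-9 * k * latticeSum B k, ?_⟩)
      push_cast
      ring
    · simp
  have hBm : ∀ p, B (latticeMul p) + B (latticeMulConj p) = -2 * B p := by
    intro p
    simp only [hB, latticeMul, latticeMulConj]
    rw [negOnePow_eq_neg_of_sub_odd (a := 6 * p.1 + 1 + p.2) (b := p.2) ⟨3 * p.1, by ring⟩,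
      negOnePow_eq_neg_of_sub_odd (a := p.2 - 6 * p.1 - 1) (b := p.2) ⟨-3 * p.1 - 1, by ring⟩]
    ring
  have hBs : ∀ p, B (latticeScale p) = 25 * B p := by
    intro p
    simp only [hB, latticeScale]
    rw [negOnePow_eq_of_sub_even (a := 25 * p.2) (b := p.2) ⟨12 * p.2, by ring⟩]
    ring
  have hqm : ∀ p, wq (latticeMul p) + wq (latticeMulConj p) = -2 * wq p := by
    intro p
    simp only [hwq, latticeMul, latticeMulConj]
    rw [negOnePow_eq_neg_of_sub_odd (b := p.1 + p.2) ⟨3 * p.1 - 2 * p.2, by ring⟩,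
      negOnePow_eq_neg_of_sub_odd (a := p.1 + 4 * p.2 + (p.2 - 6 * p.1 - 1)) (b := p.1 + p.2)
        ⟨-3 * p.1 + 2 * p.2 - 1, by ring⟩]
    ring
  have hqs : ∀ p, wq (latticeScale p) = 1 * wq p := by
    intro p
    simp only [hwq, latticeScale, one_mul]
    exact negOnePow_eq_of_sub_even ⟨12 * p.1 + 12 * p.2 + 2, by ring⟩
  have hpm : ∀ p, wp (latticeMul p) + wp (latticeMulConj p) = 2 * wp p := by
    intro p
    simp only [hwp, latticeMul, latticeMulConj]
    rw [negOnePow_eq_of_sub_even (a := p.1 - 4 * p.2) (b := p.1) ⟨-2 * p.2, by ring⟩,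
      negOnePow_eq_of_sub_even (a := p.1 + 4 * p.2) (b := p.1) ⟨2 * p.2, by ring⟩]
    ring
  have hps : ∀ p, wp (latticeScale p) = 1 * wp p := by
    intro p
    simp only [hwp, latticeScale, one_mul]
    exact negOnePow_eq_of_sub_even ⟨12 * p.1 + 2, by ring⟩
  have hB2 := latticeSum_recurrence hBm hBs m
  have hB3 := latticeSum_recurrence' hBm hBs m
  have hq2 := latticeSum_recurrence hqm hqs m
  have hq3 := latticeSum_recurrence' hqm hqs m
  have hp2 := latticeSum_recurrence hpm hps m
  have hp3 := latticeSum_recurrence' hpm hps m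
  obtain ⟨d, hd⟩ := two_dvd_latticeSum_sub_divFive m
  change latticeSum wp (5 * m + 1) - divFive (latticeSum wp) m = 2 * d at hd
  refine (hD _).trans (Int.ModEq.trans ?_
    ((((hD _).mul_left 5).add (hD _)).sub (hD0.mul_left 5)).symm)
  rw [hB3, hB2, hq3, hq2, hp3, hp2]
  -- In terms of the values at 5m + 1 and m/5, the coefficients for `B` and `wq` are multiples of 8.
  -- For `wp` the combination is ±4 times the difference of those values, which is 2d.
  refine Int.modEq_iff_dvd.mpr ⟨3 * ((-8175 * m - 1703) * latticeSum B (5 * m + 1) +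
    (19925 * m + 4150) * divFive (latticeSum B) m) - divFive (latticeSum wq) m - d, ?_⟩
  push_cast
  linear_combination -4 * hd

end Recurrence

theorem theorem1p4 :
    (∀ n : ℕ,
      DSOME (15625 * n + 651) ≡
        5 * DSOME (25 * n + 1) + DSOME (625 * n + 26) - 5 * DSOME n [ZMOD 8]) ∧
    (∀ n r : ℕ, 1 ≤ r → r ≤ 4 →
      DSOME (15625 * n + 3125 * r + 651) ≡
        5 * DSOME (25 * n + 5 * r + 1) + DSOME (625 * n + 125 * r + 26) [ZMOD 8]) := by
  refine ⟨fun n => ?_, fun n r h1 h4 => ?_⟩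
  · have h := DSOME_recurrence_modEq (5 * n)
    rw [divFive, if_pos ⟨n, rfl⟩, Nat.mul_div_cancel_left _ (by norm_num)] at h
    convert h using 3 <;> ring_nf
  · have h := DSOME_recurrence_modEq (5 * n + r)
    rw [divFive, if_neg (by omega), mul_zero, sub_zero] at h
    convert h using 3 <;> ring_nf
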